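/- Let $N\ge 1$, let $\Omega\subset\mathbb R^N$ be a bounded open set, and let $K>0$, $0<\gamma<1$ and $m\ge 2-\gamma$. Consider nonnegative solutions $u$ of $$(u^{1-\gamma})_t-K\Delta u\le 0\ \text{ in }\Omega\times(0,\infty),\qquad u(\cdot,0)=u_0\ \text{ on }\Omega,\qquad u=0\ \text{ on }\partial\Omega\times(0,\infty),$$ in the following strong sense: $u\ge 0$; $(u^{1-\gamma})_t\in L^2(\Omega\times(0,\infty))$, where $u^{1-\gamma}$ is represented so that $u^{1-\gamma}(t)-u^{1-\gamma}(s)=\int_s^t (u^{1-\gamma})_\tau\,d\tau$ a.e. in $\Omega$ for all $0\le s\le t$; for almost every $t>0$, $u(\cdot,t)\in H^1_0(\Omega)$ and $\Delta u(\cdot,t)\in L^2(\Omega)$, with the divergence formula $\int_\Omega \Delta u\,\varphi\,dx=-\int_\Omega\nabla u\cdot\nabla\varphi\,dx$ for all $\varphi\in C_c^\infty(\Omega)$; and the differential inequality holds almost everywhere in $\Omega\times(0,\infty)$. Then there is a constant $k_1>0$, depending only on $\Omega$ (and $N$), $K$, $\gamma$ and $m$, and not on the solution, such that the following holds for every such solution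 $u$ and every $t_0\ge 0$ with $\int_\Omega u(x,t_0)^m\,dx<\infty$. Put $Y(t)=\int_\Omega u(x,t)^m\,dx$ for $t\ge t_0$ and $Y_0=Y(t_0)$. Then $Y(t)$ is finite for all $t\ge t_0$, $Y$ is absolutely continuous on $[t_0,T]$ for every $T\geq t_0$ (hence differentiable at almost every $t>t_0$), and $$Y'(t)+k_1\,Y(t)^{\frac{m+\gamma}{m}}\le 0\quad\text{at every } t>t_0 \text{ at which } Y \text{ is differentiable}.$$ If $Y_0=0$, then $Y(t)=0$ for all $t\ge t_0$. If $Y_0>0$, then $$Y(t)\le\Big[\,k_1\frac{\gamma}{m}(t-t_0)+Y_0^{-\gamma/m}\Big]^{-m/\gamma}\quad\text{for all } t\ge t_0.$$ In either case $\lim_{t\to\infty}Y(t)=0$. -/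

import Mathlib

open MeasureTheory Set Filter Topology
open scoped ContDiff

namespace DegenerateEinstein

/-- The Euclidean space `ℝ^N`. -/
abbrev Space (N : ℕ) : Type := EuclideanSpace ℝ (Fin N)

/-- Test functions: smooth functions with compact support contained in `Ω`. -/
def IsTestFunction {N : ℕ} (Ω : Set (Space N)) (φ : Space N → ℝ) : Prop :=
  ContDiff ℝ ∞ φ ∧ HasCompactSupport φ ∧ tsupport φ ⊆ Ω

/-- `v` belongs to the Sobolev space `H^1_0(Ω)`, with weak gradient `G`: the pair `(v, G)` is the
limit in `L²(Ω)` of pairs `(φ n, ∇ φ n)` with test functions `φ n`. -/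
def MemH10 {N : ℕ} (Ω : Set (Space N)) (v : Space N → ℝ) (G : Space N → Space N) : Prop :=
  MemLp v 2 (volume.restrict Ω) ∧ MemLp G 2 (volume.restrict Ω) ∧
    ∃ φ : ℕ → Space N → ℝ, (∀ n, IsTestFunction Ω (φ n)) ∧
      Tendsto (fun n => eLpNorm (fun x => φ n x - v x) 2 (volume.restrict Ω)) atTop (𝓝 0) ∧
      Tendsto (fun n => eLpNorm (fun x => gradient (φ n) x - G x) 2 (volume.restrict Ω))
        atTop (𝓝 0)

/-- `l` is the distributional divergence of the vector field `G` in `Ω`, that is, the divergence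
formula `∫_Ω l φ = - ∫_Ω G · ∇φ` holds for all test functions `φ`. -/
def HasWeakDivergence {N : ℕ} (Ω : Set (Space N)) (G : Space N → Space N) (l : Space N → ℝ) :
    Prop :=
  ∀ φ : Space N → ℝ, IsTestFunction Ω φ →
    ∫ x in Ω, l x * φ x = - ∫ x in Ω, inner ℝ (G x) (gradient φ x)

/-- `g ∈ L²(Ω × (0,∞))` is the time derivative of `w` on `Ω × (0,∞)`, where `w` is given by its
representative that is continuous in time up to `t = 0`: for all `0 ≤ s ≤ t` one has
`w(t) - w(s) = ∫_s^t g(τ) dτ`, as an identity almost everywhere in `Ω`. -/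
def HasL2TimeDerivative {N : ℕ} (Ω : Set (Space N)) (w g : Space N → ℝ → ℝ) : Prop :=
  MemLp (fun z : Space N × ℝ => g z.1 z.2) 2
      ((volume.restrict Ω).prod (volume.restrict (Ioi (0 : ℝ)))) ∧
    ∀ s t : ℝ, 0 ≤ s → s ≤ t →
      ∀ᵐ x ∂(volume.restrict Ω), w x t - w x s = ∫ τ in s..t, g x τ

/-- Nonnegative (strong) solutions `u` of the initial boundary value problem
`(u^{1-γ})_t - K Δu ≤ 0` in `Ω × (0,∞)`, `u(·,0) = u₀` on `Ω`, `u = 0` on `∂Ω × (0,∞)`.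
The function `g` is `(u^{1-γ})_t`, and `G` and `l` are `∇u` and `Δu`. -/
structure IsSolution {N : ℕ} (Ω : Set (Space N)) (K γ : ℝ) (u₀ : Space N → ℝ)
    (u : Space N → ℝ → ℝ) : Prop where
  nonneg : ∀ t : ℝ, 0 ≤ t → ∀ᵐ x ∂(volume.restrict Ω), 0 ≤ u x t
  initial : ∀ᵐ x ∂(volume.restrict Ω), u x 0 = u₀ x
  equation : ∃ (g l : Space N → ℝ → ℝ) (G : Space N → ℝ → Space N),
    HasL2TimeDerivative Ω (fun x t => (u x t) ^ (1 - γ)) g ∧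
    (∀ᵐ t ∂(volume.restrict (Ioi (0 : ℝ))),
      MemH10 Ω (fun x => u x t) (fun x => G x t) ∧
      MemLp (fun x => l x t) 2 (volume.restrict Ω) ∧
      HasWeakDivergence Ω (fun x => G x t) (fun x => l x t)) ∧
    ∀ᵐ z ∂((volume.restrict Ω).prod (volume.restrict (Ioi (0 : ℝ)))),
      g z.1 z.2 - K * l z.1 z.2 ≤ 0

/-- The quantity `Y(t) = ∫_Ω u(x,t)^m dx`. -/
noncomputable def energy {N : ℕ} (Ω : Set (Space N)) (m : ℝ) (u : Space N → ℝ → ℝ) (t : ℝ) : ℝ :=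
  ∫ x in Ω, (u x t) ^ m

end DegenerateEinstein

namespace DegenerateEinstein

/-! Write `β = 1 - γ` and `w = u^β`, so that the inequality reads `w_t ≤ K Δu`. Formally, test it
with `u^(m-β)`. The time term is the derivative of a multiple of `∫ u^m`. With `p = (m-β-1)/2`, the
diffusion term is `∫ |u^p ∇u|²` up to a factor, that is, the Dirichlet integral of `u^(p+1)/(p+1)`.
Poincaré's inequality bounds it below by a multiple of `∫ u^(2p+2) = ∫ u^(m+γ)`. The condition `m ≥
2 - γ` is exactly `p ≥ 0`. Hence, with `E_q = ∫ u^q`, `E_m(t) + κ ∫_s^t E_(m+γ) ≤ E_m(s)` for `s ≤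
t`, which is `lenergy_add_le`. It is proved with powers cut off to bounded functions, for which the
chain rules in space (`MemH10.comp`) and in time (`integral_comp_primitive_mul`) are available, and
Fatou's lemma then removes the cut-off.

By Hölder on the bounded set `Ω`, `E_(m+γ)` dominates a multiple of `E_m^(1+γ/m)`. Since `E_m`
decreases, this gives `Y(t) + k₁ (t-s) Y(t)^(1+γ/m) ≤ Y(s)` (`energy_add_le`). Right difference
quotients yield the differential inequality, and comparison with the explicit solution of the
equation yields the decay.

Absolute continuity is the delicate point, because `u^(m-β) w_t` need not be integrable up to `t₀`.
After `t₀` the energy inequality can be iterated: finiteness of `E_m` forces finiteness of `E_(m+γ)`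
at every later time, and so on for all higher exponents. Thus `u^(m-β)` is in `L²` uniformly on
`[t₁, ∞)` for each `t₁ > t₀`, and since `w_t` is in `L²`, `Y` is absolutely continuous there.
Fatou's lemma and monotonicity give right continuity at `t₀`, and a decreasing function with these
two properties is absolutely continuous up to `t₀`. -/

/-! ### Test functions and the divergence formula on `H^1_0`. -/

theorem IsTestFunction.continuous_gradient {N : ℕ} {Ω : Set (Space N)} {φ : Space N → ℝ}
    (h : IsTestFunction Ω φ) : Continuous (gradient φ) :=
  (InnerProductSpace.toDual ℝ (Space N)).symm.continuous.comp
    (h.1.continuous_fderiv (by simp))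

theorem IsTestFunction.memLp {N : ℕ} {Ω : Set (Space N)} {φ : Space N → ℝ}
    (h : IsTestFunction Ω φ) (p : ENNReal) : MemLp φ p (volume.restrict Ω) :=
  (h.1.continuous.memLp_of_hasCompactSupport h.2.1).restrict _

theorem IsTestFunction.hasCompactSupport_gradient {N : ℕ} {Ω : Set (Space N)} {φ : Space N → ℝ}
    (h : IsTestFunction Ω φ) : HasCompactSupport (gradient φ) :=
  (h.2.1.fderiv (𝕜 := ℝ)).comp_left (map_zero _)

theorem IsTestFunction.memLp_gradient {N : ℕ} {Ω : Set (Space N)} {φ : Space N → ℝ}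
    (h : IsTestFunction Ω φ) (p : ENNReal) : MemLp (gradient φ) p (volume.restrict Ω) :=
  (h.continuous_gradient.memLp_of_hasCompactSupport h.hasCompactSupport_gradient).restrict _

theorem MemLp.integrable_inner_of_two {α E : Type*} [MeasurableSpace α]
    {μ : Measure α} [NormedAddCommGroup E] [InnerProductSpace ℝ E] {f g : α → E}
    (hf : MemLp f 2 μ) (hg : MemLp g 2 μ) : Integrable (fun x => inner ℝ (f x) (g x)) μ := by
  refine (hf.norm.integrable_mul hg.norm).mono' (hf.1.inner hg.1) (Eventually.of_forall fun x => ?_)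
  exact norm_inner_le_norm _ _

/-- The product of an `L²` function with an `L²`-convergent sequence converges in mean. -/
theorem tendsto_integral_inner_of_tendsto_eLpNorm {α E : Type*} [MeasurableSpace α]
    {μ : Measure α} [NormedAddCommGroup E] [InnerProductSpace ℝ E] {f g : α → E} {u : ℕ → α → E}
    (hf : MemLp f 2 μ) (hg : MemLp g 2 μ) (hu : ∀ n, MemLp (u n) 2 μ)
    (h : Tendsto (fun n => eLpNorm (fun x => u n x - g x) 2 μ) atTop (𝓝 0)) :
    Tendsto (fun n => ∫ x, inner ℝ (f x) (u n x) ∂μ) atTop (𝓝 (∫ x, inner ℝ (f x) (g x) ∂μ)) := by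
  have hle : ∀ n, |(∫ x, inner ℝ (f x) (u n x) ∂μ) - ∫ x, inner ℝ (f x) (g x) ∂μ| ≤
      (eLpNorm f 2 μ * eLpNorm (fun x => u n x - g x) 2 μ).toReal := by
    intro n
    rw [← integral_sub (MemLp.integrable_inner_of_two hf (hu n)) (MemLp.integrable_inner_of_two hf hg)]
    have hsub : MemLp (fun x => u n x - g x) 2 μ := (hu n).sub hg
    have hb := eLpNorm_le_eLpNorm_mul_eLpNorm_of_nnnorm (p := 2) (q := 2) (r := 1) hf.1
      hsub.1 (fun x y => inner ℝ x y) 1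
      (Eventually.of_forall fun x => by
        simpa using nnnorm_inner_le_nnnorm (𝕜 := ℝ) (f x) (u n x - g x))
    simp_rw [← inner_sub_right]
    rw [← Real.norm_eq_abs, ← toReal_enorm]
    refine ENNReal.toReal_mono (ENNReal.mul_ne_top hf.2.ne hsub.2.ne) ?_
    refine (enorm_integral_le_lintegral_enorm _).trans ?_
    simpa [eLpNorm_one_eq_lintegral_enorm] using hb
  have hlim : Tendsto (fun n => (eLpNorm f 2 μ * eLpNorm (fun x => u n x - g x) 2 μ).toReal) atTop
      (𝓝 0) := by
    have := (ENNReal.tendsto_toReal ENNReal.zero_ne_top).comp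
      ((ENNReal.Tendsto.const_mul (a := eLpNorm f 2 μ) h (Or.inr hf.2.ne)).trans (by simp))
    simpa [Function.comp_def] using this
  rw [tendsto_iff_norm_sub_tendsto_zero]
  exact squeeze_zero (fun _ => norm_nonneg _) hle hlim

/-- The divergence formula extends from test functions to `H^1_0`. -/
theorem HasWeakDivergence.integral_mul_eq {N : ℕ} {Ω : Set (Space N)} {G Gψ : Space N → Space N}
    {l ψ : Space N → ℝ} (h : HasWeakDivergence Ω G l) (hG : MemLp G 2 (volume.restrict Ω))
    (hl : MemLp l 2 (volume.restrict Ω)) (hψ : MemH10 Ω ψ Gψ) :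
    ∫ x in Ω, l x * ψ x = - ∫ x in Ω, inner ℝ (G x) (Gψ x) := by
  obtain ⟨hψ2, hGψ2, φ, hφ, h1, h2⟩ := hψ
  have t1 := tendsto_integral_inner_of_tendsto_eLpNorm hl hψ2 (fun n => (hφ n).memLp 2) h1
  have t2 := tendsto_integral_inner_of_tendsto_eLpNorm hG hGψ2 (fun n => (hφ n).memLp_gradient 2) h2
  simp only [RCLike.inner_apply, conj_trivial, mul_comm _ (l _)] at t1
  refine tendsto_nhds_unique t1 ?_
  simp_rw [h _ (hφ _)]
  exact t2.neg

/-! ### The chain rule in `H^1_0`. -/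

theorem gradient_comp_left {N : ℕ} {P : ℝ → ℝ} {φ : Space N → ℝ} {x : Space N} {p : ℝ}
    (hP : HasDerivAt P p (φ x)) (hφ : DifferentiableAt ℝ φ x) :
    gradient (fun y => P (φ y)) x = p • gradient φ x := by
  have := (hP.comp_hasFDerivAt x hφ.hasFDerivAt).fderiv
  simp only [Function.comp_def] at this
  simp [gradient, this]

theorem abs_primitive_sub_le {r : ℝ → ℝ} (hr : Continuous r) {C : ℝ} (hC : ∀ s, |r s| ≤ C)
    (a b : ℝ) : |(∫ s in (0:ℝ)..a, r s) - ∫ s in (0:ℝ)..b, r s| ≤ C * |a - b| := by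
  rw [intervalIntegral.integral_interval_sub_left (hr.intervalIntegrable _ _)
    (hr.intervalIntegrable _ _)]
  exact intervalIntegral.norm_integral_le_of_norm_le_const (f := r) fun x _ => hC x

theorem continuous_primitive_zero {r : ℝ → ℝ} (hr : Continuous r) :
    Continuous fun a => ∫ s in (0:ℝ)..a, r s :=
  intervalIntegral.continuous_primitive (fun _ _ => hr.intervalIntegrable _ _) 0

/-- The chain rule approximates `r` by polynomials, because a primitive of a merely continuous `r`
would not keep `φ` smooth. Starting the primitive at `0` preserves the support condition. -/
theorem IsTestFunction.polynomial_comp {N : ℕ} {Ω : Set (Space N)} {φ : Space N → ℝ}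
    (h : IsTestFunction Ω φ) (p : Polynomial ℝ) :
    IsTestFunction Ω (fun x => ∫ s in (0:ℝ)..φ x, p.eval s) := by
  have hd : ∀ s, HasDerivAt (fun a => ∫ s in (0:ℝ)..a, p.eval s) (p.eval s) s := fun s =>
    p.continuous.integral_hasStrictDerivAt 0 s |>.hasDerivAt
  have hP : ContDiff ℝ ∞ (fun a => ∫ s in (0:ℝ)..a, p.eval s) := by
    rw [contDiff_infty_iff_deriv]
    refine ⟨fun s => (hd s).differentiableAt, ?_⟩
    rw [show deriv (fun a => ∫ s in (0:ℝ)..a, p.eval s) = fun s => p.eval s from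
      funext fun s => (hd s).deriv]
    simpa using Polynomial.contDiff_aeval (𝕜 := ℝ) p ∞
  refine ⟨hP.comp h.1, h.2.1.comp_left (g := fun a => ∫ s in (0:ℝ)..a, p.eval s) (by simp), ?_⟩
  exact (tsupport_comp_subset (g := fun a => ∫ s in (0:ℝ)..a, p.eval s) (by simp) φ).trans h.2.2

/-- Chain rule in `H^1_0` for a `C¹` function with bounded derivative `r`, vanishing at `0`. -/
theorem MemH10.comp {N : ℕ} {Ω : Set (Space N)} {v : Space N → ℝ} {G : Space N → Space N}
    (h : MemH10 Ω v G) {r : ℝ → ℝ} (hr : Continuous r) {C : ℝ} (hC : ∀ s, |r s| ≤ C) :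
    MemH10 Ω (fun x => ∫ s in (0:ℝ)..v x, r s) (fun x => r (v x) • G x) := by
  obtain ⟨hv, hG, φ, hφ, h1, h2⟩ := h
  have hC0 : 0 ≤ C := (abs_nonneg _).trans (hC 0)
  set μ := volume.restrict Ω with hμ
  -- Almost everywhere convergence along a subsequence is needed for `r (φ n) → r v`, since `r` is
  -- only continuous.
  obtain ⟨ns, hns, hae⟩ : ∃ ns : ℕ → ℕ, StrictMono ns ∧
      ∀ᵐ x ∂μ, Tendsto (fun i => φ (ns i) x) atTop (𝓝 (v x)) :=
    (tendstoInMeasure_of_tendsto_eLpNorm (p := 2) (by simp) (fun n => ((hφ n).memLp 2).1) hv.1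
      h1).exists_seq_tendsto_ae
  -- Weierstrass on `[-B, B]`, which contains the range of the compactly supported `φ (ns n)` and
  -- also `0`.
  have hpol : ∀ n : ℕ, ∃ p : Polynomial ℝ, ∀ x, ∀ s ∈ uIcc 0 (φ (ns n) x),
      |p.eval s - r s| < 1 / ((n : ℝ) + 1) := by
    intro n
    obtain ⟨B, hB⟩ := (hφ (ns n)).2.1.exists_bound_of_continuous (hφ (ns n)).1.continuous
    obtain ⟨p, hp⟩ := exists_polynomial_near_of_continuousOn (-B) B r hr.continuousOn
      (1 / ((n : ℝ) + 1)) (by positivity)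
    refine ⟨p, fun x s hs => hp s ?_⟩
    have hx := abs_le.1 (hB x)
    have hB0 : 0 ≤ B := (norm_nonneg _).trans (hB x)
    exact uIcc_subset_Icc ⟨by linarith, hB0⟩ ⟨hx.1, hx.2⟩ hs
  choose p hp using hpol
  have hvR : MemLp (fun x => ∫ s in (0:ℝ)..v x, r s) 2 μ := by
    refine MemLp.of_le_mul (c := C) hv
      ((continuous_primitive_zero hr).comp_aestronglyMeasurable hv.1)
      (Eventually.of_forall fun x => ?_)
    simpa using abs_primitive_sub_le hr hC (v x) 0
  have hrm : AEStronglyMeasurable (fun x => r (v x)) μ := hr.comp_aestronglyMeasurable hv.1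
  have hGR : MemLp (fun x => r (v x) • G x) 2 μ := by
    refine MemLp.of_le_mul (c := C) hG (hrm.smul hG.1) (Eventually.of_forall fun x => ?_)
    rw [norm_smul]
    exact mul_le_mul_of_nonneg_right (hC _) (norm_nonneg _)
  have h1' := h1.comp hns.tendsto_atTop
  have h2' := h2.comp hns.tendsto_atTop
  have hone : Tendsto (fun n : ℕ => ENNReal.ofReal (1 / ((n : ℝ) + 1))) atTop (𝓝 0) := by
    simpa using ENNReal.tendsto_ofReal (tendsto_one_div_add_atTop_nhds_zero_nat (𝕜 := ℝ))
  have hone1 : ∀ n : ℕ, 1 / ((n : ℝ) + 1) ≤ 1 := fun n => by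
    rw [div_le_one (by positivity)]; linarith [n.cast_nonneg (α := ℝ)]
  refine ⟨hvR, hGR, fun n x => ∫ s in (0:ℝ)..φ (ns n) x, (p n).eval s,
    fun n => (hφ (ns n)).polynomial_comp (p n), ?_, ?_⟩
  · have hle : ∀ n, eLpNorm (fun x => (∫ s in (0:ℝ)..φ (ns n) x, (p n).eval s) -
        ∫ s in (0:ℝ)..v x, r s) 2 μ ≤
        ENNReal.ofReal (C + 1) * eLpNorm (fun x => φ (ns n) x - v x) 2 μ +
        ENNReal.ofReal (1 / ((n : ℝ) + 1)) * eLpNorm v 2 μ := by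
      intro n
      have hsub : MemLp (fun x => φ (ns n) x - v x) 2 μ := ((hφ (ns n)).memLp 2).sub hv
      calc _ ≤ eLpNorm (fun x => (C + 1) * ‖φ (ns n) x - v x‖ + (1 / ((n : ℝ) + 1)) * ‖v x‖) 2 μ := by
            refine eLpNorm_mono_real fun x => ?_
            have e1 : |(∫ s in (0:ℝ)..φ (ns n) x, (p n).eval s) - ∫ s in (0:ℝ)..φ (ns n) x, r s| ≤
                1 / ((n : ℝ) + 1) * |φ (ns n) x| := by
              rw [← intervalIntegral.integral_sub ((p n).continuous.intervalIntegrable _ _)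
                (hr.intervalIntegrable _ _)]
              simpa using intervalIntegral.norm_integral_le_of_norm_le_const (a := 0)
                (b := φ (ns n) x) (C := 1 / ((n : ℝ) + 1))
                (f := fun s => (p n).eval s - r s)
                fun s hs => (hp n x s (uIoc_subset_uIcc hs)).le
            have e2 := abs_primitive_sub_le hr hC (φ (ns n) x) (v x)
            have e3 : |φ (ns n) x| ≤ |φ (ns n) x - v x| + |v x| := by
              simpa using abs_add_le (φ (ns n) x - v x) (v x)
            have e4 : 1 / ((n : ℝ) + 1) * |φ (ns n) x| ≤
                1 * |φ (ns n) x - v x| + 1 / ((n : ℝ) + 1) * |v x| := by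
              have := hone1 n
              have h0 : (0:ℝ) ≤ 1 / ((n : ℝ) + 1) := by positivity
              nlinarith [abs_nonneg (φ (ns n) x - v x), mul_le_mul_of_nonneg_left e3 h0]
            simp only [Real.norm_eq_abs]
            calc _ ≤ _ := abs_sub_le _ (∫ s in (0:ℝ)..φ (ns n) x, r s) _
              _ ≤ _ := by linarith
        _ ≤ _ := by
            refine (eLpNorm_add_le (hsub.norm.const_mul _).1 (hv.norm.const_mul _).1
              (by norm_num)).trans (le_of_eq ?_)
            have := eLpNorm_const_smul (C + 1) (fun x => ‖φ (ns n) x - v x‖) 2 μ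
            have t := eLpNorm_const_smul (1 / ((n : ℝ) + 1)) (fun x => ‖v x‖) 2 μ
            simp only [Pi.smul_def, smul_eq_mul, eLpNorm_norm] at this t
            rw [this, t, Real.enorm_of_nonneg (by positivity), Real.enorm_of_nonneg (by positivity)]
    refine tendsto_of_tendsto_of_tendsto_of_le_of_le tendsto_const_nhds ?_ (fun _ => zero_le) hle
    have := (ENNReal.Tendsto.const_mul (a := ENNReal.ofReal (C + 1)) h1' (Or.inr (by simp))).add
      (ENNReal.Tendsto.mul_const (b := eLpNorm v 2 μ) hone (Or.inr hv.2.ne))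
    simpa using this
  · have hgrad : ∀ n x, gradient (fun y => ∫ s in (0:ℝ)..φ (ns n) y, (p n).eval s) x =
        (p n).eval (φ (ns n) x) • gradient (φ (ns n)) x := fun n x =>
      gradient_comp_left ((p n).continuous.integral_hasStrictDerivAt 0 _).hasDerivAt
        ((hφ (ns n)).1.differentiable (by simp) x)
    -- The one error term not controlled by the two given convergences: dominated convergence with
    -- majorant `2C|G|`.
    have hlast : Tendsto (fun n => eLpNorm (fun x => (r (φ (ns n) x) - r (v x)) • G x) 2 μ) atTop
        (𝓝 0) := by
      have hm : ∀ n, AEStronglyMeasurable (fun x => (r (φ (ns n) x) - r (v x)) • G x) μ := fun n =>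
        ((hr.comp_aestronglyMeasurable ((hφ (ns n)).memLp 2).1).sub hrm).smul hG.1
      have key : Tendsto (fun n => ∫⁻ x, ‖(r (φ (ns n) x) - r (v x)) • G x‖ₑ ^ (2:ℝ) ∂μ) atTop
          (𝓝 (∫⁻ x, 0 ∂μ)) := by
        refine tendsto_lintegral_of_dominated_convergence'
          (fun x => ‖(2 * C) • G x‖ₑ ^ (2:ℝ)) (fun n => (hm n).enorm.pow_const _) ?_ ?_ ?_
        · intro n
          refine Eventually.of_forall fun x => ?_
          refine ENNReal.rpow_le_rpow ?_ (by norm_num)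
          rw [enorm_le_iff_norm_le, norm_smul, norm_smul]
          refine mul_le_mul_of_nonneg_right ?_ (norm_nonneg _)
          rw [Real.norm_of_nonneg (r := 2 * C) (by positivity)]
          refine (norm_sub_le _ _).trans ?_
          rw [Real.norm_eq_abs, Real.norm_eq_abs]
          linarith [hC (φ (ns n) x), hC (v x)]
        · have := (hG.const_smul (2 * C)).2
          rw [eLpNorm_lt_top_iff_lintegral_rpow_enorm_lt_top (by simp) (by simp)] at this
          simpa using this.ne
        · filter_upwards [hae] with x hx
          have : Tendsto (fun n => (r (φ (ns n) x) - r (v x)) • G x) atTop (𝓝 0) := by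
            have := ((hr.tendsto (v x)).comp hx).sub_const (r (v x))
            simpa using this.smul_const (G x)
          have h3 := (ENNReal.continuous_rpow_const (y := (2:ℝ))).tendsto _ |>.comp this.enorm
          simpa [Function.comp_def] using h3
      have h4 := (ENNReal.continuous_rpow_const (y := (1 / 2:ℝ))).tendsto _ |>.comp key
      refine (h4.congr fun n => ?_).trans (by simp)
      rw [eLpNorm_eq_lintegral_rpow_enorm_toReal (by simp) (by simp)]
      simp
    have hle : ∀ n, eLpNorm (fun x => gradient (fun y => ∫ s in (0:ℝ)..φ (ns n) y, (p n).eval s) x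
        - r (v x) • G x) 2 μ ≤
        (ENNReal.ofReal (C + 1) * eLpNorm (fun x => gradient (φ (ns n)) x - G x) 2 μ +
        ENNReal.ofReal (1 / ((n : ℝ) + 1)) * eLpNorm G 2 μ) +
        eLpNorm (fun x => (r (φ (ns n) x) - r (v x)) • G x) 2 μ := by
      intro n
      have hsub : MemLp (fun x => gradient (φ (ns n)) x - G x) 2 μ :=
        ((hφ (ns n)).memLp_gradient 2).sub hG
      have hm : AEStronglyMeasurable (fun x => (r (φ (ns n) x) - r (v x)) • G x) μ :=
        ((hr.comp_aestronglyMeasurable ((hφ (ns n)).memLp 2).1).sub hrm).smul hG.1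
      calc _ ≤ eLpNorm (fun x => ((C + 1) * ‖gradient (φ (ns n)) x - G x‖ +
              (1 / ((n : ℝ) + 1)) * ‖G x‖) + ‖(r (φ (ns n) x) - r (v x)) • G x‖) 2 μ := by
            refine eLpNorm_mono_real fun x => ?_
            rw [hgrad]
            have e1 := (hp n x _ right_mem_uIcc).le
            have e2 : |(p n).eval (φ (ns n) x)| ≤ C + 1 := by
              have := abs_add_le ((p n).eval (φ (ns n) x) - r (φ (ns n) x)) (r (φ (ns n) x))
              rw [sub_add_cancel] at this
              linarith [hC (φ (ns n) x), hone1 n]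
            have e3 : (p n).eval (φ (ns n) x) • gradient (φ (ns n)) x - r (v x) • G x =
                (p n).eval (φ (ns n) x) • (gradient (φ (ns n)) x - G x) +
                ((p n).eval (φ (ns n) x) - r (φ (ns n) x)) • G x +
                (r (φ (ns n) x) - r (v x)) • G x := by
              module
            rw [e3]
            refine (norm_add₃_le).trans ?_
            rw [norm_smul, norm_smul, Real.norm_eq_abs, Real.norm_eq_abs]
            gcongr
        _ ≤ _ := by
            refine (eLpNorm_add_le (((hsub.norm.const_mul _).1).add (hG.norm.const_mul _).1)
              hm.norm (by norm_num)).trans ?_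
            rw [eLpNorm_norm]
            gcongr
            refine (eLpNorm_add_le (hsub.norm.const_mul _).1 (hG.norm.const_mul _).1
              (by norm_num)).trans (le_of_eq ?_)
            have := eLpNorm_const_smul (C + 1) (fun x => ‖gradient (φ (ns n)) x - G x‖) 2 μ
            have t := eLpNorm_const_smul (1 / ((n : ℝ) + 1)) (fun x => ‖G x‖) 2 μ
            simp only [Pi.smul_def, smul_eq_mul, eLpNorm_norm] at this t
            rw [this, t, Real.enorm_of_nonneg (by positivity), Real.enorm_of_nonneg (by positivity)]
    refine tendsto_of_tendsto_of_tendsto_of_le_of_le tendsto_const_nhds ?_ (fun _ => zero_le) hle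
    have := ((ENNReal.Tendsto.const_mul (a := ENNReal.ofReal (C + 1)) h2' (Or.inr (by simp))).add
      (ENNReal.Tendsto.mul_const (b := eLpNorm G 2 μ) hone (Or.inr hG.2.ne))).add hlast
    simpa using this

/-! ### Poincaré's inequality and the dissipation estimate. -/

theorem IsTestFunction.integral_eq {N : ℕ} {Ω : Set (Space N)} {φ : Space N → ℝ}
    (h : IsTestFunction Ω φ) {ψ : Space N → ℝ} (hψ : ∀ x, x ∉ tsupport φ → ψ x = 0) :
    ∫ x in Ω, ψ x = ∫ x, ψ x :=
  setIntegral_eq_integral_of_forall_compl_eq_zero fun x hx => hψ x fun hx' => hx (h.2.2 hx')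

/-- Poincaré's inequality for test functions. -/
theorem IsTestFunction.integral_sq_le {N : ℕ} (hN : 1 ≤ N) {Ω : Set (Space N)} {ρ : ℝ}
    (hρ : Ω ⊆ Metric.closedBall 0 ρ) {φ : Space N → ℝ} (h : IsTestFunction Ω φ) :
    ∫ x in Ω, ‖φ x‖ ^ 2 ≤ 4 * ρ ^ 2 * ∫ x in Ω, ‖gradient φ x‖ ^ 2 := by
  have hφ0 : ∀ x, x ∉ tsupport φ → φ x = 0 := fun x => image_eq_zero_of_notMem_tsupport
  have hg0 : ∀ x, x ∉ tsupport φ → gradient φ x = 0 := fun x hx => by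
    have : fderiv ℝ φ x = 0 := by
      have := support_fderiv_subset ℝ (f := φ)
      by_contra hne
      exact hx (this hne)
    simp [gradient, this]
  rw [h.integral_eq fun x hx => by simp [hφ0 x hx], h.integral_eq fun x hx => by simp [hg0 x hx]]
  set i : Fin N := ⟨0, hN⟩
  set e : Space N := EuclideanSpace.single i 1 with he
  have hdiff : Differentiable ℝ φ := h.1.differentiable (by simp)
  have hcφ := h.1.continuous
  have hcg := h.continuous_gradient
  have hfd : ∀ x v, fderiv ℝ φ x v = inner ℝ (gradient φ x) v := fun x v => by
    rw [gradient, InnerProductSpace.toDual_symm_apply]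
  have hf2 : ∀ x, fderiv ℝ (fun y => φ y ^ 2) x e = 2 * φ x * inner ℝ (gradient φ x) e := by
    intro x
    rw [((hdiff x).hasFDerivAt.pow 2).fderiv, smul_apply, hfd]
    norm_num
  have hgx : ∀ x : Space N, HasFDerivAt (fun y : Space N => y i) (EuclideanSpace.proj (𝕜 := ℝ) i) x :=
    fun x => (EuclideanSpace.proj (𝕜 := ℝ) i).hasFDerivAt
  have hg1 : ∀ x : Space N, fderiv ℝ (fun y : Space N => y i) x e = 1 := by
    intro x
    rw [(hgx x).fderiv]
    simp [he]
  have hci : Continuous fun y : Space N => y i := (EuclideanSpace.proj (𝕜 := ℝ) i).continuous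
  have int_of : ∀ ψ : Space N → ℝ, Continuous ψ → (∀ x, x ∉ tsupport φ → ψ x = 0) →
      Integrable ψ := fun ψ hψ h0 =>
    hψ.integrable_of_hasCompactSupport (HasCompactSupport.intro h.2.1 h0)
  have i1 : Integrable fun x => φ x ^ 2 := int_of _ (by fun_prop) fun x hx => by simp [hφ0 x hx]
  have i2 : Integrable fun x => ‖gradient φ x‖ ^ 2 :=
    int_of _ (by fun_prop) fun x hx => by simp [hg0 x hx]
  have i3 : Integrable fun x => (2 * φ x * inner ℝ (gradient φ x) e) * x i :=
    int_of _ (by fun_prop) fun x hx => by simp [hφ0 x hx]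
  have i4 : Integrable fun x => φ x ^ 2 * x i :=
    int_of _ (by fun_prop) fun x hx => by simp [hφ0 x hx]
  -- Integrate by parts in `∫ φ² · 1`, where `1` is the derivative of the coordinate `x i` along
  -- `e`; on `Ω` this coordinate is at most `ρ` in absolute value.
  have key := integral_mul_fderiv_eq_neg_fderiv_mul_of_integrable (μ := volume)
    (f := fun x => φ x ^ 2) (g := fun x : Space N => x i) (v := e)
    (by simpa only [hf2] using i3) (by simpa only [hg1, mul_one] using i1) i4
    (fun x _ => (hdiff x).pow 2) (fun x _ => (hgx x).differentiableAt)
  simp only [hf2, hg1, mul_one] at key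
  -- Young's inequality with weights chosen so that half of `∫ φ²` is absorbed on the left.
  have hpt : ∀ x, -((2 * φ x * inner ℝ (gradient φ x) e) * x i) ≤
      1 / 2 * φ x ^ 2 + 2 * ρ ^ 2 * ‖gradient φ x‖ ^ 2 := by
    intro x
    by_cases hx : x ∈ tsupport φ
    · have h1 : |x i| ≤ ρ := by
        have : ‖x‖ ≤ ρ := by simpa using hρ (h.2.2 hx)
        exact (by simpa using PiLp.norm_apply_le x i : |x i| ≤ ‖x‖).trans this
      have h2 : |inner ℝ (gradient φ x) e| ≤ ‖gradient φ x‖ := by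
        simpa [he] using abs_real_inner_le_norm (gradient φ x) e
      set b := inner ℝ (gradient φ x) e
      have h3 : (b * x i) ^ 2 ≤ ρ ^ 2 * ‖gradient φ x‖ ^ 2 := by
        rw [← mul_pow, ← sq_abs, abs_mul, mul_comm ρ]
        gcongr
      nlinarith [sq_nonneg (φ x + 2 * (b * x i))]
    · simp only [hφ0 x hx]
      simp
      positivity
  have hle : ∫ x, φ x ^ 2 ≤ ∫ x, (1 / 2 * φ x ^ 2 + 2 * ρ ^ 2 * ‖gradient φ x‖ ^ 2) := by
    rw [key, ← integral_neg]
    exact integral_mono i3.neg ((i1.const_mul _).add (i2.const_mul _)) hpt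
  rw [integral_add (i1.const_mul _) (i2.const_mul _), integral_const_mul, integral_const_mul] at hle
  simp only [Real.norm_eq_abs, sq_abs]
  linarith

/-- In norm form Poincaré's inequality extends to limits of test functions by the triangle
inequality; this lemma and the next translate between the two forms. -/
theorem eLpNorm_two_le_of_integral_sq_le {α E F : Type*} [MeasurableSpace α] {μ : Measure α}
    [NormedAddCommGroup E] [NormedAddCommGroup F] {f : α → E} {g : α → F} {C : ℝ} (hC : 0 ≤ C)
    (hf : MemLp f 2 μ) (hg : MemLp g 2 μ) (h : ∫ x, ‖f x‖ ^ 2 ∂μ ≤ C ^ 2 * ∫ x, ‖g x‖ ^ 2 ∂μ) :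
    eLpNorm f 2 μ ≤ ENNReal.ofReal C * eLpNorm g 2 μ := by
  rw [hf.eLpNorm_eq_integral_rpow_norm (by simp) (by simp),
    hg.eLpNorm_eq_integral_rpow_norm (by simp) (by simp), ← ENNReal.ofReal_mul hC]
  refine ENNReal.ofReal_le_ofReal ?_
  simp only [ENNReal.toReal_ofNat, Real.rpow_ofNat, ← one_div, ← Real.sqrt_eq_rpow]
  refine Real.sqrt_le_iff.2 ⟨by positivity, h.trans (le_of_eq ?_)⟩
  rw [mul_pow, Real.sq_sqrt (integral_nonneg fun _ => by positivity)]

theorem integral_sq_le_of_eLpNorm_two_le {α E F : Type*} [MeasurableSpace α] {μ : Measure α}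
    [NormedAddCommGroup E] [NormedAddCommGroup F] {f : α → E} {g : α → F} {C : ℝ} (hC : 0 ≤ C)
    (hf : MemLp f 2 μ) (hg : MemLp g 2 μ)
    (h : eLpNorm f 2 μ ≤ ENNReal.ofReal C * eLpNorm g 2 μ) :
    ∫ x, ‖f x‖ ^ 2 ∂μ ≤ C ^ 2 * ∫ x, ‖g x‖ ^ 2 ∂μ := by
  rw [hf.eLpNorm_eq_integral_rpow_norm (by simp) (by simp),
    hg.eLpNorm_eq_integral_rpow_norm (by simp) (by simp), ← ENNReal.ofReal_mul hC,
    ENNReal.ofReal_le_ofReal_iff (by positivity)] at h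
  simp only [ENNReal.toReal_ofNat, Real.rpow_ofNat, ← one_div, ← Real.sqrt_eq_rpow] at h
  refine (Real.sqrt_le_iff.1 h).2.trans (le_of_eq ?_)
  rw [mul_pow, Real.sq_sqrt (integral_nonneg fun _ => by positivity)]

/-- Poincaré's inequality in `H^1_0`. -/
theorem MemH10.integral_sq_le {N : ℕ} (hN : 1 ≤ N) {Ω : Set (Space N)} {ρ : ℝ} (hρ0 : 0 ≤ ρ)
    (hρ : Ω ⊆ Metric.closedBall 0 ρ) {v : Space N → ℝ} {G : Space N → Space N}
    (h : MemH10 Ω v G) : ∫ x in Ω, ‖v x‖ ^ 2 ≤ (2 * ρ) ^ 2 * ∫ x in Ω, ‖G x‖ ^ 2 := by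
  obtain ⟨hv, hG, φ, hφ, h1, h2⟩ := h
  refine integral_sq_le_of_eLpNorm_two_le (by positivity) hv hG ?_
  have hle : ∀ n, eLpNorm v 2 (volume.restrict Ω) ≤
      eLpNorm (fun x => φ n x - v x) 2 (volume.restrict Ω) + ENNReal.ofReal (2 * ρ) *
      (eLpNorm (fun x => gradient (φ n) x - G x) 2 (volume.restrict Ω) +
        eLpNorm G 2 (volume.restrict Ω)) := by
    intro n
    have hs1 : MemLp (fun x => φ n x - v x) 2 (volume.restrict Ω) := ((hφ n).memLp 2).sub hv
    have hs2 : MemLp (fun x => gradient (φ n) x - G x) 2 (volume.restrict Ω) :=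
      ((hφ n).memLp_gradient 2).sub hG
    have e1 : eLpNorm v 2 (volume.restrict Ω) ≤
        eLpNorm (fun x => φ n x - v x) 2 (volume.restrict Ω) +
          eLpNorm (φ n) 2 (volume.restrict Ω) := by
      have := eLpNorm_sub_le ((hφ n).memLp 2).1 hs1.1 (p := 2) (by norm_num)
      rw [add_comm]
      convert this using 2
      ext x; simp
    have e2 : eLpNorm (gradient (φ n)) 2 (volume.restrict Ω) ≤
        eLpNorm (fun x => gradient (φ n) x - G x) 2 (volume.restrict Ω) +
          eLpNorm G 2 (volume.restrict Ω) := by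
      have := eLpNorm_add_le hs2.1 hG.1 (p := 2) (by norm_num)
      convert this using 2
      ext1 x; simp
    refine e1.trans ?_
    gcongr
    refine (eLpNorm_two_le_of_integral_sq_le (C := 2 * ρ) (by positivity) ((hφ n).memLp 2)
      ((hφ n).memLp_gradient 2) ?_).trans (by gcongr)
    convert (hφ n).integral_sq_le hN hρ using 2
    ring
  refine ge_of_tendsto' (x := atTop) ?_ hle
  have := h1.add (ENNReal.Tendsto.const_mul (a := ENNReal.ofReal (2 * ρ))
    (h2.add_const (eLpNorm G 2 (volume.restrict Ω))) (Or.inr ENNReal.ofReal_ne_top))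
  simpa using this

/-- The energy dissipation inequality: the diffusion term tested with `F(v)`, where `F' = r²`,
controls the square of the primitive of `r`. -/
theorem exists_dissipation {N : ℕ} (hN : 1 ≤ N) {Ω : Set (Space N)}
    (hΩb : Bornology.IsBounded Ω) :
    ∃ c : ℝ, 0 < c ∧ ∀ (v l : Space N → ℝ) (G : Space N → Space N) (r : ℝ → ℝ) (C : ℝ),
      MemH10 Ω v G → MemLp l 2 (volume.restrict Ω) → HasWeakDivergence Ω G l → Continuous r →
      (∀ s, |r s| ≤ C) →
      c * ∫ x in Ω, (∫ s in (0:ℝ)..v x, r s) ^ 2 ≤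
        -∫ x in Ω, l x * ∫ s in (0:ℝ)..v x, r s ^ 2 := by
  obtain ⟨ρ, hρ0, hρ⟩ : ∃ ρ : ℝ, 0 < ρ ∧ Ω ⊆ Metric.closedBall 0 ρ := by
    obtain ⟨ρ, hρ⟩ := hΩb.subset_closedBall 0
    exact ⟨max ρ 1, by positivity, hρ.trans (Metric.closedBall_subset_closedBall (le_max_left _ _))⟩
  refine ⟨((2 * ρ) ^ 2)⁻¹, by positivity, fun v l G r C hv hl hdiv hr hC => ?_⟩
  have hP := (hv.comp hr hC).integral_sq_le hN hρ0.le hρ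
  have hr2 : Continuous fun s => r s ^ 2 := hr.pow 2
  have hC2 : ∀ s, |r s ^ 2| ≤ C ^ 2 := fun s => by
    rw [abs_pow]; exact pow_le_pow_left₀ (abs_nonneg _) (hC s) 2
  -- `∇F(v) = r(v)² ∇v` and `∇R(v) = r(v) ∇v` for the primitives `F` of `r²` and `R` of `r`, so `∫
  -- ∇v · ∇F(v) = ∫ |∇R(v)|²`, to which Poincaré's inequality `hP` applies.
  rw [hdiv.integral_mul_eq hv.2.1 hl (hv.comp hr2 hC2), neg_neg,
    inv_mul_le_iff₀ (by positivity)]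
  refine le_of_eq_of_le (by simp) (hP.trans (le_of_eq ?_))
  congr 2
  ext x
  rw [norm_smul, mul_pow, real_inner_smul_right, real_inner_self_eq_norm_sq]
  simp

/-! ### Absolutely continuous functions of one variable. -/

/-- The sums defining absolute continuity of `f` are at most `C` times those of `φ`. In every
application `φ` is the primitive of an integrable function. -/
theorem AbsolutelyContinuousOnInterval.of_dist_le {X Y : Type*} [PseudoMetricSpace X]
    [PseudoMetricSpace Y] {f : ℝ → X} {φ : ℝ → Y}
    {a b C : ℝ} (hφ : AbsolutelyContinuousOnInterval φ a b)
    (h : ∀ s ∈ uIcc a b, ∀ t ∈ uIcc a b, dist (f s) (f t) ≤ C * dist (φ s) (φ t)) :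
    AbsolutelyContinuousOnInterval f a b := by
  have hlim := Tendsto.const_mul C hφ
  rw [mul_zero] at hlim
  refine squeeze_zero' (Eventually.of_forall fun E => Finset.sum_nonneg fun _ _ => dist_nonneg)
    ?_ hlim
  filter_upwards [mem_inf_of_right (mem_principal_self _)] with E hE
  rw [Finset.mul_sum]
  exact Finset.sum_le_sum fun i hi => h _ (hE.1 i hi).1 _ (hE.1 i hi).2

/-- Chain rule for the composition of a `C¹` function with a primitive of an integrable function. -/
theorem integral_comp_primitive_mul {g w h : ℝ → ℝ} {s t B : ℝ} (hst : s ≤ t)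
    (hg : IntervalIntegrable g volume s t) (hw : ∀ τ ∈ Icc s t, w τ = w s + ∫ σ in s..τ, g σ)
    (hh : Continuous h) (hB : ∀ σ, |h σ| ≤ B) :
    (∫ σ in (0:ℝ)..w t, h σ) - ∫ σ in (0:ℝ)..w s, h σ = ∫ τ in s..t, h (w τ) * g τ := by
  set p : ℝ → ℝ := fun τ => w s + ∫ σ in s..τ, g σ with hp
  set H : ℝ → ℝ := fun x => ∫ σ in (0:ℝ)..x, h σ with hH
  have hpr := hg.absolutelyContinuousOnInterval_intervalIntegral (c := s) left_mem_uIcc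
  -- `H` is Lipschitz because `h` is bounded, so the fundamental theorem of calculus holds for `H ∘
  -- p`.
  have hAC : AbsolutelyContinuousOnInterval (fun τ => H (p τ)) s t := by
    refine AbsolutelyContinuousOnInterval.of_dist_le (C := B) hpr fun a _ b _ => ?_
    have := abs_primitive_sub_le hh hB (p a) (p b)
    simpa [hp, Real.dist_eq] using this
  have key := hAC.integral_deriv_eq_sub
  have h1 : H (p t) = H (w t) := by rw [hw t (right_mem_Icc.2 hst)]
  have h2 : H (p s) = H (w s) := by simp [hp]
  rw [h1, h2] at key
  rw [← key]
  refine intervalIntegral.integral_congr_ae ?_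
  filter_upwards [hg.ae_hasDerivAt_integral] with τ hτ hmem
  have hmem' := uIoc_subset_uIcc hmem
  have hd : HasDerivAt p (g τ) τ := (hτ hmem' s left_mem_uIcc).const_add _
  rw [hw τ (uIcc_of_le hst ▸ hmem')]
  exact ((hh.integral_hasStrictDerivAt 0 (p τ)).hasDerivAt.comp τ hd).deriv

/-- A decreasing function that is continuous at the left end of an interval and absolutely
continuous away from it is absolutely continuous. -/
theorem AntitoneOn.absolutelyContinuousOnInterval {f : ℝ → ℝ} {a b : ℝ} (hab : a ≤ b)
    (hf : AntitoneOn f (Icc a b)) (ha : Tendsto f (𝓝[>] a) (𝓝 (f a)))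
    (h : ∀ c, a < c → c ≤ b → AbsolutelyContinuousOnInterval f c b) :
    AbsolutelyContinuousOnInterval f a b := by
  -- The derivative of a monotone function is integrable up to the endpoint `a`. This lets `c ↓ a`
  -- in the fundamental theorem of calculus on `[c, t]`.
  have hint : IntervalIntegrable (deriv f) volume a b := by
    have : MonotoneOn (-f) (uIcc a b) := by rw [uIcc_of_le hab]; exact hf.neg
    have h2 := this.intervalIntegrable_deriv.neg
    refine h2.congr fun x _ => ?_
    simp
  have hpr := hint.absolutelyContinuousOnInterval_intervalIntegral (c := a) left_mem_uIcc
  have hrep : ∀ t ∈ Icc a b, f t = f a + ∫ σ in a..t, deriv f σ := by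
    intro t ht
    rcases ht.1.eq_or_lt with rfl | hat
    · simp
    have hev : ∀ᶠ c in 𝓝[>] a, f t = f c + ((∫ σ in a..t, deriv f σ) - ∫ σ in a..c, deriv f σ) := by
      filter_upwards [Ioo_mem_nhdsGT hat] with c hc
      have hcb : c ≤ b := hc.2.le.trans ht.2
      have hsub : ∀ x ∈ Icc a b, IntervalIntegrable (deriv f) volume a x := fun x hx =>
        hint.mono_set (by rw [uIcc_of_le hab, uIcc_of_le hx.1]; exact Icc_subset_Icc_right hx.2)
      rw [intervalIntegral.integral_interval_sub_left (hsub t ht) (hsub c ⟨hc.1.le, hcb⟩),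
        ((h c hc.1 hcb).mono (by
          rw [uIcc_of_le hcb, uIcc_of_le hc.2.le]
          exact Icc_subset_Icc_right ht.2)).integral_deriv_eq_sub]
      ring
    have hcont : Tendsto (fun c => ∫ σ in a..c, deriv f σ) (𝓝[>] a) (𝓝 0) := by
      have := hpr.continuousOn a left_mem_uIcc
      have h3 := this.mono_left (nhdsWithin_mono a (s := Ioc a b) (by
        rw [uIcc_of_le hab]; exact Ioc_subset_Icc_self))
      rw [nhdsWithin_Ioc_eq_nhdsGT (hat.trans_le ht.2)] at h3
      simpa using h3
    have hlim := ha.add ((tendsto_const_nhds (x := ∫ σ in a..t, deriv f σ)).sub hcont)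
    rw [sub_zero] at hlim
    exact tendsto_nhds_unique (tendsto_const_nhds.congr' hev) hlim
  refine AbsolutelyContinuousOnInterval.of_dist_le (C := 1) hpr fun s hs t ht => ?_
  rw [uIcc_of_le hab] at hs ht
  simp [hrep s hs, hrep t ht]

/-! ### The integrated differential inequality and its consequences. -/

/-- If `f(t) + k (t - s) f(t)^q ≤ f(s)` for `s ≤ t`, then `f' + k f^q ≤ 0`. -/
theorem deriv_add_mul_rpow_le_of_forall_add_le {f : ℝ → ℝ} {t₀ k q : ℝ} (hq : 0 ≤ q)
    (h : ∀ s t, t₀ ≤ s → s ≤ t → f t + k * (t - s) * f t ^ q ≤ f s) {t : ℝ} (ht : t₀ ≤ t)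
    (hd : DifferentiableAt ℝ f t) : deriv f t + k * f t ^ q ≤ 0 := by
  have hslope := (hasDerivAt_iff_tendsto_slope.1 hd.hasDerivAt).mono_left
    (nhdsWithin_mono t (fun x (hx : x ∈ Ioi t) => ne_of_gt hx))
  have hc : Tendsto (fun z => -(k * f z ^ q)) (𝓝[>] t) (𝓝 (-(k * f t ^ q))) :=
    (((hd.continuousAt.tendsto.mono_left nhdsWithin_le_nhds).rpow_const (Or.inr hq)).const_mul k).neg
  have := le_of_tendsto_of_tendsto hslope hc (by
    filter_upwards [self_mem_nhdsWithin] with z hz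
    have hz' : 0 < z - t := sub_pos.2 hz
    rw [slope_def_field, div_le_iff₀ hz']
    linarith [h t z ht (le_of_lt hz)])
  linarith

/-- The decay estimate for solutions of the differential inequality `f' + k f^(1+θ) ≤ 0`. -/
theorem le_rpow_of_forall_add_le {f : ℝ → ℝ} {t₀ k θ : ℝ} (hk : 0 < k) (hθ : 0 < θ)
    (hcont : ∀ T, ContinuousOn f (Icc t₀ T))
    (h : ∀ s t, t₀ ≤ s → s ≤ t → f t + k * (t - s) * f t ^ (1 + θ) ≤ f s) (h0 : 0 < f t₀)
    {t : ℝ} (ht : t₀ ≤ t) :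
    f t ≤ (k * θ * (t - t₀) + f t₀ ^ (-θ)) ^ (-(1 / θ)) := by
  have hpos0 : 0 < f t₀ ^ (-θ) := Real.rpow_pos_of_pos h0 _
  -- The comparison theorem needs a strict inequality between slopes at a contact point. A smaller
  -- `k'` supplies it, and `k' → k` at the end.
  have main : ∀ k', 0 < k' → k' < k → f t ≤ (k' * θ * (t - t₀) + f t₀ ^ (-θ)) ^ (-(1 / θ)) := by
    intro k' hk' hkk
    have hpos : ∀ x, t₀ ≤ x → 0 < k' * θ * (x - t₀) + f t₀ ^ (-θ) := fun x hx => by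
      have : 0 ≤ k' * θ * (x - t₀) := mul_nonneg (by positivity) (sub_nonneg.2 hx)
      linarith
    have hder : ∀ x, t₀ ≤ x → HasDerivAt (fun x => (k' * θ * (x - t₀) + f t₀ ^ (-θ)) ^ (-(1 / θ)))
        (-(k' * ((k' * θ * (x - t₀) + f t₀ ^ (-θ)) ^ (-(1 / θ))) ^ (1 + θ))) x := by
      intro x hx
      have h1 : HasDerivAt (fun x => k' * θ * (x - t₀) + f t₀ ^ (-θ)) (k' * θ) x := by
        simpa using (((hasDerivAt_id x).sub_const t₀).const_mul (k' * θ)).add_const (f t₀ ^ (-θ))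
      convert h1.rpow_const (p := -(1 / θ)) (Or.inl (hpos x hx).ne') using 1
      rw [← Real.rpow_mul (hpos x hx).le, show -(1 / θ) * (1 + θ) = -(1 / θ) - 1 by
        field_simp; ring]
      field_simp
    refine image_le_of_liminf_slope_right_lt_deriv_boundary' (hcont t)
      (f' := fun x => -(k * f x ^ (1 + θ))) ?_ ?_
      (fun x hx => (hder x hx.1).continuousAt.continuousWithinAt)
      (fun x hx => (hder x hx.1).hasDerivWithinAt) ?_ (right_mem_Icc.2 ht)
    · intro x hx r hr
      have hc : Tendsto (fun z => -(k * f z ^ (1 + θ))) (𝓝[>] x) (𝓝 (-(k * f x ^ (1 + θ)))) := by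
        have h1 : Tendsto f (𝓝[>] x) (𝓝 (f x)) := by
          have h2 := (hcont t x ⟨hx.1, hx.2.le⟩).mono_left (nhdsWithin_mono x (s := Ioc x t)
            fun y hy => ⟨hx.1.trans hy.1.le, hy.2⟩)
          rwa [nhdsWithin_Ioc_eq_nhdsGT hx.2] at h2
        exact ((h1.rpow_const (Or.inr (by positivity))).const_mul k).neg
      refine Eventually.frequently ?_
      filter_upwards [hc.eventually_lt_const hr, self_mem_nhdsWithin] with z hz hxz
      refine lt_of_le_of_lt ?_ hz
      have hz' : 0 < z - x := sub_pos.2 hxz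
      rw [slope_def_field, div_le_iff₀ hz']
      linarith [h x z hx.1 (le_of_lt hxz)]
    · rw [sub_self, mul_zero, zero_add, ← Real.rpow_mul h0.le]
      simp [hθ.ne']
    · intro x hx hfx
      rw [hfx]
      have : 0 < ((k' * θ * (x - t₀) + f t₀ ^ (-θ)) ^ (-(1 / θ))) ^ (1 + θ) :=
        Real.rpow_pos_of_pos (Real.rpow_pos_of_pos (hpos x hx.1) _) _
      nlinarith
  have hne : k * θ * (t - t₀) + f t₀ ^ (-θ) ≠ 0 := by
    have : 0 ≤ k * θ * (t - t₀) := mul_nonneg (by positivity) (sub_nonneg.2 ht)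
    positivity
  have hlim : Tendsto (fun k' => (k' * θ * (t - t₀) + f t₀ ^ (-θ)) ^ (-(1 / θ))) (𝓝[<] k)
      (𝓝 ((k * θ * (t - t₀) + f t₀ ^ (-θ)) ^ (-(1 / θ)))) := by
    have : ContinuousAt (fun k' => (k' * θ * (t - t₀) + f t₀ ^ (-θ)) ^ (-(1 / θ))) k :=
      ContinuousAt.rpow_const (by fun_prop) (Or.inl hne)
    exact this.tendsto.mono_left nhdsWithin_le_nhds
  refine ge_of_tendsto hlim ?_
  filter_upwards [Ioo_mem_nhdsLT hk] with k' hk'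
  exact main k' hk'.1 hk'.2

/-- Superadditivity of the lower limit: Fatou's lemma can be applied separately to the energy and to
the dissipation. -/
theorem ENNReal.add_le_of_le_liminf {A B D : ENNReal} {a b : ℕ → ENNReal}
    (hA : A ≤ liminf a atTop) (hB : B ≤ liminf b atTop) (h : ∀ n, a n + b n ≤ D) : A + B ≤ D := by
  rw [liminf_eq_iSup_iInf_of_nat] at hA hB
  refine (add_le_add hA hB).trans ?_
  rw [ENNReal.iSup_add_iSup_of_monotone]
  · exact iSup_le fun n => (add_le_add (iInf₂_le n le_rfl) (iInf₂_le n le_rfl)).trans (h n)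
  · exact fun m n hmn => biInf_mono fun i hi => le_trans hmn hi
  · exact fun m n hmn => biInf_mono fun i hi => le_trans hmn hi

/-! ### Truncated powers -/

section TruncatedPowers

/-- The power `|s|^p`, cut off to a bounded continuous function that agrees with it on
`[-n, n]`. -/
noncomputable def truncPow (p : ℝ) (n : ℕ) (s : ℝ) : ℝ :=
  |s| ^ p * max 0 (min 1 (n + 1 - |s|))

variable {p : ℝ} {n : ℕ} {s : ℝ}

theorem continuous_truncPow (hp : 0 ≤ p) : Continuous (truncPow p n) := by
  unfold truncPow
  exact (continuous_abs.rpow_const fun _ => Or.inr hp).mul (by fun_prop)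

theorem truncPow_nonneg : 0 ≤ truncPow p n s := by
  unfold truncPow; positivity

theorem truncPow_le : truncPow p n s ≤ |s| ^ p :=
  mul_le_of_le_one_right (by positivity) (max_le zero_le_one (min_le_left _ _))

theorem truncPow_eq (h : |s| ≤ n) : truncPow p n s = |s| ^ p := by
  have : min 1 ((n : ℝ) + 1 - |s|) = 1 := min_eq_left (by linarith)
  simp [truncPow, this]

theorem truncPow_eq_zero (h : (n : ℝ) + 1 ≤ |s|) : truncPow p n s = 0 := by
  have : max 0 (min 1 ((n : ℝ) + 1 - |s|)) = 0 :=
    max_eq_left ((min_le_right _ _).trans (by linarith))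
  simp [truncPow, this]

theorem hasCompactSupport_truncPow : HasCompactSupport (truncPow p n) := by
  refine HasCompactSupport.intro (isCompact_Icc (a := -((n : ℝ) + 1)) (b := n + 1)) fun s hs => ?_
  refine truncPow_eq_zero ?_
  by_contra hlt
  exact hs (abs_le.1 (not_le.1 hlt).le)

theorem exists_abs_truncPow_le (hp : 0 ≤ p) (n : ℕ) : ∃ C, ∀ s, |truncPow p n s| ≤ C :=
  hasCompactSupport_truncPow.exists_bound_of_continuous (continuous_truncPow hp)

theorem integral_truncPow_eq (hp : 0 ≤ p) (hs : 0 ≤ s) (hsn : s ≤ n) :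
    ∫ σ in (0:ℝ)..s, truncPow p n σ = s ^ (p + 1) / (p + 1) := by
  have : ∫ σ in (0:ℝ)..s, truncPow p n σ = ∫ σ in (0:ℝ)..s, σ ^ p := by
    refine intervalIntegral.integral_congr fun σ hσ => ?_
    rw [uIcc_of_le hs] at hσ
    have h1 : |σ| = σ := abs_of_nonneg hσ.1
    simp only [truncPow_eq (p := p) (n := n) (s := σ) (h1.le.trans (hσ.2.trans hsn)), h1]
  rw [this, integral_rpow (Or.inl (by linarith)), Real.zero_rpow (by linarith), sub_zero]

theorem integral_truncPow_sq_eq (hp : 0 ≤ p) (hs : 0 ≤ s) (hsn : s ≤ n) :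
    ∫ σ in (0:ℝ)..s, truncPow p n σ ^ 2 = s ^ (2 * p + 1) / (2 * p + 1) := by
  have : ∫ σ in (0:ℝ)..s, truncPow p n σ ^ 2 = ∫ σ in (0:ℝ)..s, σ ^ (2 * p) := by
    refine intervalIntegral.integral_congr fun σ hσ => ?_
    rw [uIcc_of_le hs] at hσ
    have h1 : |σ| = σ := abs_of_nonneg hσ.1
    simp only [truncPow_eq (p := p) (n := n) (s := σ) (h1.le.trans (hσ.2.trans hsn)), h1]
    rw [mul_comm, Real.rpow_mul hσ.1, Real.rpow_ofNat]
  rw [this, integral_rpow (Or.inl (by linarith)), Real.zero_rpow (by linarith), sub_zero]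

theorem integral_truncPow_sq_le (hp : 0 ≤ p) (hs : 0 ≤ s) :
    ∫ σ in (0:ℝ)..s, truncPow p n σ ^ 2 ≤ s ^ (2 * p + 1) / (2 * p + 1) := by
  have : ∫ σ in (0:ℝ)..s, truncPow p n σ ^ 2 ≤ ∫ σ in (0:ℝ)..s, σ ^ (2 * p) := by
    refine intervalIntegral.integral_mono_on hs
      (((continuous_truncPow hp).pow 2).intervalIntegrable _ _)
      (intervalIntegral.intervalIntegrable_rpow (Or.inl (by positivity))) fun σ hσ => ?_
    rw [mul_comm, Real.rpow_mul hσ.1, Real.rpow_ofNat]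
    refine pow_le_pow_left₀ truncPow_nonneg (truncPow_le.trans_eq ?_) 2
    rw [abs_of_nonneg hσ.1]
  rwa [integral_rpow (Or.inl (by linarith)), Real.zero_rpow (by linarith), sub_zero] at this

theorem integral_truncPow_sq_nonneg (hs : 0 ≤ s) : 0 ≤ ∫ σ in (0:ℝ)..s, truncPow p n σ ^ 2 :=
  intervalIntegral.integral_nonneg hs fun _ _ => sq_nonneg _

/-- This is why the cut-off descends to zero instead of levelling off: the square is integrable on
the line, so its primitive is bounded, and `truncFlux` times an integrable time derivative is
integrable. -/
theorem exists_abs_integral_truncPow_sq_le (hp : 0 ≤ p) (n : ℕ) :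
    ∃ B, ∀ s, |∫ σ in (0:ℝ)..s, truncPow p n σ ^ 2| ≤ B := by
  have hi : Integrable fun σ => truncPow p n σ ^ 2 := by
    simp_rw [sq]
    exact ((continuous_truncPow hp).mul (continuous_truncPow hp)).integrable_of_hasCompactSupport
      hasCompactSupport_truncPow.mul_right
  refine ⟨∫ σ, ‖truncPow p n σ ^ 2‖, fun s => ?_⟩
  exact intervalIntegral.norm_integral_le_integral_norm_uIoc.trans
    (setIntegral_le_integral hi.norm (ae_of_all _ fun _ => norm_nonneg _))

/-- The primitive of `truncPow p n ^ 2`, as a function of `w = s^β`. -/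
noncomputable def truncFlux (p β : ℝ) (n : ℕ) (σ : ℝ) : ℝ :=
  ∫ s in (0:ℝ)..(max σ 0) ^ (1 / β), truncPow p n s ^ 2

variable {β σ w : ℝ}

theorem continuous_truncFlux (hp : 0 ≤ p) (hβ : 0 < β) : Continuous (truncFlux p β n) := by
  have h2 : Continuous fun s => truncPow p n s ^ 2 := (continuous_truncPow hp).pow 2
  exact (continuous_primitive_zero h2).comp
    ((continuous_id.max continuous_const).rpow_const fun _ => Or.inr (by positivity))

theorem truncFlux_nonneg : 0 ≤ truncFlux p β n σ :=
  integral_truncPow_sq_nonneg (by positivity)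

theorem exists_abs_truncFlux_le (hp : 0 ≤ p) (β : ℝ) (n : ℕ) :
    ∃ B, ∀ σ, |truncFlux p β n σ| ≤ B :=
  (exists_abs_integral_truncPow_sq_le hp n).imp fun _ hB _ => hB _

theorem truncFlux_le (hp : 0 ≤ p) (hσ : 0 ≤ σ) :
    truncFlux p β n σ ≤ σ ^ ((2 * p + 1) / β) / (2 * p + 1) := by
  refine (integral_truncPow_sq_le hp (by positivity)).trans (le_of_eq ?_)
  rw [max_eq_left hσ, ← Real.rpow_mul hσ]
  congr 2; ring

theorem truncFlux_eq (hp : 0 ≤ p) (hσ : 0 ≤ σ) (h : σ ^ (1 / β) ≤ n) :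
    truncFlux p β n σ = σ ^ ((2 * p + 1) / β) / (2 * p + 1) := by
  rw [truncFlux, max_eq_left hσ, integral_truncPow_sq_eq hp (by positivity) h,
    ← Real.rpow_mul hσ]
  congr 2; ring

/-- For `2p + 1 = m - β` and `w = u^β` the right side is `β / (m (m - β)) * u^m`, the energy
density. -/
theorem integral_rpow_div (hp : 0 ≤ p) (hβ : 0 < β) :
    ∫ σ in (0:ℝ)..w, σ ^ ((2 * p + 1) / β) / (2 * p + 1) =
      β / ((2 * p + 1 + β) * (2 * p + 1)) * w ^ ((2 * p + 1 + β) / β) := by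
  have h1 : 0 < (2 * p + 1) / β := by positivity
  have h2 : (2 * p + 1) / β + 1 = (2 * p + 1 + β) / β := by field_simp
  rw [intervalIntegral.integral_div, integral_rpow (Or.inl (by linarith)),
    Real.zero_rpow (by linarith), sub_zero, h2]
  field_simp

theorem integral_truncFlux_nonneg (hw : 0 ≤ w) : 0 ≤ ∫ σ in (0:ℝ)..w, truncFlux p β n σ :=
  intervalIntegral.integral_nonneg hw fun _ _ => truncFlux_nonneg

theorem integral_truncFlux_le (hp : 0 ≤ p) (hβ : 0 < β) (hw : 0 ≤ w) :
    ∫ σ in (0:ℝ)..w, truncFlux p β n σ ≤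
      β / ((2 * p + 1 + β) * (2 * p + 1)) * w ^ ((2 * p + 1 + β) / β) := by
  rw [← integral_rpow_div hp hβ]
  refine intervalIntegral.integral_mono_on hw ((continuous_truncFlux hp hβ).intervalIntegrable _ _)
    ((intervalIntegral.intervalIntegrable_rpow (Or.inl (by positivity))).div_const _)
    fun σ hσ => truncFlux_le hp hσ.1

theorem integral_truncFlux_eq (hp : 0 ≤ p) (hβ : 0 < β) (hw : 0 ≤ w) (h : w ^ (1 / β) ≤ n) :
    ∫ σ in (0:ℝ)..w, truncFlux p β n σ =
      β / ((2 * p + 1 + β) * (2 * p + 1)) * w ^ ((2 * p + 1 + β) / β) := by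
  rw [← integral_rpow_div hp hβ]
  refine intervalIntegral.integral_congr fun σ hσ => ?_
  rw [uIcc_of_le hw] at hσ
  exact truncFlux_eq hp hσ.1 ((Real.rpow_le_rpow hσ.1 hσ.2 (by positivity)).trans h)

end TruncatedPowers

/-! ### A jointly measurable representative. -/

/-- `w` and `g` are jointly measurable versions of `u^β` and of its time derivative, such that
`w(x, ·)` is a primitive of `g(x, ·)` for almost every `x`. -/
structure IsRepresentative {N : ℕ} (Ω : Set (Space N)) (K β : ℝ) (u : Space N → ℝ → ℝ)
    (w g : Space N × ℝ → ℝ) : Prop where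
  stronglyMeasurable : StronglyMeasurable w
  stronglyMeasurable_deriv : StronglyMeasurable g
  memLp : MemLp g 2 ((volume.restrict Ω).prod (volume.restrict (Ioi (0 : ℝ))))
  primitive : ∀ᵐ x ∂(volume.restrict Ω), ∀ s t : ℝ, 0 ≤ s → s ≤ t →
    IntervalIntegrable (fun τ => g (x, τ)) volume s t ∧
      w (x, t) = w (x, s) + ∫ τ in s..t, g (x, τ)
  eq_rpow : ∀ t : ℝ, 0 ≤ t → ∀ᵐ x ∂(volume.restrict Ω), w (x, t) = u x t ^ β
  nonneg : ∀ t : ℝ, 0 ≤ t → ∀ᵐ x ∂(volume.restrict Ω), 0 ≤ u x t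
  diffusion : ∀ᵐ t ∂(volume.restrict (Ioi (0 : ℝ))), ∃ (l : Space N → ℝ) (G : Space N → Space N),
    MemH10 Ω (fun x => u x t) G ∧ MemLp l 2 (volume.restrict Ω) ∧ HasWeakDivergence Ω G l ∧
      ∀ᵐ x ∂(volume.restrict Ω), g (x, t) ≤ K * l x

theorem ae_swap_of_ae_prod {α β : Type*} [MeasurableSpace α] [MeasurableSpace β] {μ : Measure α}
    {ν : Measure β} [SFinite μ] [SFinite ν] {P : α × β → Prop} (h : ∀ᵐ z ∂μ.prod ν, P z) :
    ∀ᵐ y ∂ν, ∀ᵐ x ∂μ, P (x, y) := by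
  have : ∀ᵐ z ∂ν.prod μ, P z.swap :=
    (Measure.measurePreserving_swap (μ := ν) (ν := μ)).quasiMeasurePreserving.ae h
  exact Measure.ae_ae_of_ae_prod this

theorem ae_intervalIntegrable_of_memLp_two {α : Type*} [MeasurableSpace α] {μ : Measure α}
    [SFinite μ] {g : α × ℝ → ℝ} (hgm : StronglyMeasurable g)
    (hg : MemLp g 2 (μ.prod (volume.restrict (Ioi (0 : ℝ))))) :
    ∀ᵐ x ∂μ, ∀ s t : ℝ, 0 ≤ s → s ≤ t → IntervalIntegrable (fun τ => g (x, τ)) volume s t := by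
  filter_upwards [hg.integrable_sq.prod_right_ae] with x hx s t hs hst
  have hm : StronglyMeasurable fun τ => g (x, τ) := hgm.comp_measurable (by fun_prop)
  have h2 : MemLp (fun τ => g (x, τ)) 2 (volume.restrict (Ioi (0 : ℝ))) :=
    (memLp_two_iff_integrable_sq hm.aestronglyMeasurable).2 hx
  rw [intervalIntegrable_iff_integrableOn_Ioc_of_le hst]
  have h3 : MemLp (fun τ => g (x, τ)) 2 (volume.restrict (Ioc s t)) :=
    h2.mono_measure (Measure.restrict_mono (fun τ hτ => lt_of_le_of_lt hs hτ.1) le_rfl)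
  exact h3.integrable (by norm_num)

/-- `u` is not assumed jointly measurable, and the null set in the increment identity may depend on
`s` and `t`. Rebuilding `w` as an initial value plus a time integral gives one null set for all
times, at the price that `w = u^β` holds only almost everywhere at each fixed time. -/
theorem IsSolution.exists_isRepresentative {N : ℕ} {Ω : Set (Space N)} {K γ : ℝ}
    (hγ : γ < 1) {u₀ : Space N → ℝ} {u : Space N → ℝ → ℝ}
    (h : IsSolution Ω K γ u₀ u) : ∃ w g, IsRepresentative Ω K (1 - γ) u w g := by
  obtain ⟨g, l, G, ⟨hg2, hinc⟩, hH, hineq⟩ := h.equation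
  set μ := volume.restrict Ω with hμ
  set gm := hg2.1.mk _ with hgm
  have hgms : StronglyMeasurable gm := hg2.1.stronglyMeasurable_mk
  have hgae : ∀ᵐ z ∂(μ.prod (volume.restrict (Ioi (0 : ℝ)))), g z.1 z.2 = gm z := hg2.1.ae_eq_mk
  have hgm2 : MemLp gm 2 (μ.prod (volume.restrict (Ioi (0 : ℝ)))) := (memLp_congr_ae hgae).1 hg2
  have hint := ae_intervalIntegrable_of_memLp_two hgms hgm2
  have hinc' : ∀ s t : ℝ, 0 ≤ s → s ≤ t →
      ∀ᵐ x ∂μ, u x t ^ (1 - γ) - u x s ^ (1 - γ) = ∫ τ in s..t, gm (x, τ) := by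
    intro s t hs hst
    filter_upwards [hinc s t hs hst, Measure.ae_ae_of_ae_prod hgae] with x hx hgx
    rw [hx]
    refine intervalIntegral.integral_congr_ae ?_
    rw [ae_restrict_iff' measurableSet_Ioi] at hgx
    filter_upwards [hgx] with τ hτ hmem
    rw [uIoc_of_le hst] at hmem
    exact hτ (lt_of_le_of_lt hs hmem.1)
  have hIm : ∀ t, StronglyMeasurable fun x => ∫ τ in Ioc 0 t, gm (x, τ) := fun t =>
    hgms.integral_prod_right'
  -- Measurability of the initial slice is inherited from any later slice that lies in `L²`, by
  -- subtracting the increment.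
  obtain ⟨τ₀, hτ₀, hHτ₀⟩ : ∃ τ₀ : ℝ, 0 < τ₀ ∧ AEStronglyMeasurable (fun x => u x τ₀) μ := by
    have : ∃ᶠ t in ae (volume.restrict (Ioi (0:ℝ))), 0 < t ∧
        AEStronglyMeasurable (fun x => u x t) μ := by
      have : (ae (volume.restrict (Ioi (0:ℝ)))).NeBot := by
        rw [ae_neBot]; simp [Measure.restrict_eq_zero]
      refine Eventually.frequently ?_
      filter_upwards [hH, ae_restrict_mem measurableSet_Ioi] with t ht ht0
      exact ⟨ht0, ht.1.1.1⟩
    exact this.exists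
  have h0m : AEStronglyMeasurable (fun x => u x 0 ^ (1 - γ)) μ := by
    have h1 : AEStronglyMeasurable (fun x => u x τ₀ ^ (1 - γ) - ∫ τ in Ioc 0 τ₀, gm (x, τ)) μ :=
      ((continuous_id.rpow_const fun _ => Or.inr (by linarith)).comp_aestronglyMeasurable hHτ₀).sub
        (hIm τ₀).aestronglyMeasurable
    refine h1.congr ?_
    filter_upwards [hinc' 0 τ₀ le_rfl hτ₀.le] with x hx
    rw [intervalIntegral.integral_of_le hτ₀.le] at hx
    linarith
  set w₀ := h0m.mk _ with hw₀
  have hw₀m : StronglyMeasurable w₀ := h0m.stronglyMeasurable_mk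
  refine ⟨fun z => w₀ z.1 + ∫ τ in Ioc 0 z.2, gm (z.1, τ), gm, ?_, hgms, hgm2, ?_, ?_, h.nonneg, ?_⟩
  · refine (hw₀m.comp_measurable measurable_fst).add ?_
    -- Joint measurability of an integral with a moving endpoint: move the endpoint into an
    -- indicator.
    have : StronglyMeasurable fun q : (Space N × ℝ) × ℝ =>
        {q : (Space N × ℝ) × ℝ | 0 < q.2 ∧ q.2 ≤ q.1.2}.indicator (fun q => gm (q.1.1, q.2)) q := by
      refine (hgms.comp_measurable (by fun_prop)).indicator ?_
      exact (measurableSet_lt measurable_const measurable_snd).inter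
        (measurableSet_le measurable_snd (measurable_snd.comp measurable_fst))
    have h2 := this.integral_prod_right' (ν := volume)
    convert h2 using 2 with z
    rw [← integral_indicator measurableSet_Ioc]
    rfl
  · filter_upwards [hint] with x hx s t hs hst
    refine ⟨hx s t hs hst, ?_⟩
    rw [← intervalIntegral.integral_of_le hs, ← intervalIntegral.integral_of_le (hs.trans hst),
      ← intervalIntegral.integral_add_adjacent_intervals (hx 0 s le_rfl hs) (hx s t hs hst)]
    ring
  · intro t ht
    filter_upwards [hinc' 0 t le_rfl ht, h0m.ae_eq_mk] with x hx hx0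
    rw [← intervalIntegral.integral_of_le ht, ← hx]
    simp only [hw₀, ← hx0]
    ring
  · filter_upwards [hH, ae_swap_of_ae_prod hineq, ae_swap_of_ae_prod hgae] with t ht hi hgt
    refine ⟨_, _, ht.1, ht.2.1, ht.2.2, ?_⟩
    filter_upwards [hi, hgt] with x hx hgx
    rw [← hgx]
    linarith

namespace IsRepresentative

variable {N : ℕ} {Ω : Set (Space N)} {K β : ℝ} {u : Space N → ℝ → ℝ} {w g : Space N × ℝ → ℝ}

theorem ae_eq (h : IsRepresentative Ω K β u w g) (hβ : 0 < β) {t : ℝ} (ht : 0 ≤ t) :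
    ∀ᵐ x ∂(volume.restrict Ω), u x t = (max (w (x, t)) 0) ^ (1 / β) := by
  filter_upwards [h.eq_rpow t ht, h.nonneg t ht] with x hx hx0
  rw [hx, max_eq_left (by positivity), ← Real.rpow_mul hx0, mul_one_div_cancel hβ.ne', Real.rpow_one]

theorem ae_nonneg (h : IsRepresentative Ω K β u w g) {t : ℝ} (ht : 0 ≤ t) :
    ∀ᵐ x ∂(volume.restrict Ω), 0 ≤ w (x, t) := by
  filter_upwards [h.eq_rpow t ht, h.nonneg t ht] with x hx hx0
  rw [hx]; positivity

theorem measurable_slice (h : IsRepresentative Ω K β u w g) (t : ℝ) :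
    Measurable fun x => w (x, t) :=
  h.stronglyMeasurable.measurable.comp (by fun_prop)

theorem aestronglyMeasurable (h : IsRepresentative Ω K β u w g) (hβ : 0 < β) {t : ℝ} (ht : 0 ≤ t) :
    AEStronglyMeasurable (fun x => u x t) (volume.restrict Ω) := by
  have hm := h.measurable_slice t
  have : Measurable fun x => (max (w (x, t)) 0) ^ (1 / β) :=
    (hm.max measurable_const).pow_const _
  exact this.aestronglyMeasurable.congr ((h.ae_eq hβ ht).mono fun x hx => hx.symm)

end IsRepresentative

/-! ### The energy inequality. -/

/-- `c` is a constant in the energy dissipation inequality on `Ω`. -/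
def IsDissipationConstant {N : ℕ} (Ω : Set (Space N)) (c : ℝ) : Prop :=
  ∀ (v l : Space N → ℝ) (G : Space N → Space N) (r : ℝ → ℝ) (C : ℝ),
    MemH10 Ω v G → MemLp l 2 (volume.restrict Ω) → HasWeakDivergence Ω G l → Continuous r →
    (∀ s, |r s| ≤ C) →
    c * ∫ x in Ω, (∫ s in (0:ℝ)..v x, r s) ^ 2 ≤ -∫ x in Ω, l x * ∫ s in (0:ℝ)..v x, r s ^ 2

theorem lintegral_le_liminf_of_ae_le {α : Type*} [MeasurableSpace α] {μ : Measure α}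
    {f : α → ENNReal} {F : ℕ → α → ENNReal} (hF : ∀ n, Measurable (F n))
    (h : ∀ᵐ x ∂μ, f x ≤ liminf (fun n => F n x) atTop) :
    ∫⁻ x, f x ∂μ ≤ liminf (fun n => ∫⁻ x, F n x ∂μ) atTop :=
  (lintegral_mono_ae h).trans (lintegral_liminf_le hF)

theorem le_liminf_of_eventually_eq {a : ENNReal} {b : ℕ → ENNReal} (h : ∀ᶠ n in atTop, b n = a) :
    a ≤ liminf b atTop :=
  (Tendsto.liminf_eq (tendsto_const_nhds.congr' (h.mono fun _ hn => hn.symm))).ge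

namespace IsRepresentative

variable {N : ℕ} {Ω : Set (Space N)} {K β c p : ℝ} {u : Space N → ℝ → ℝ} {w g : Space N × ℝ → ℝ}

/-- The diffusion estimate at almost every time. -/
theorem ae_flux_le (h : IsRepresentative Ω K β u w g) (hβ : 0 < β) (hK : 0 < K)
    (hc : IsDissipationConstant Ω c) (hp : 0 ≤ p) (n : ℕ) :
    ∀ᵐ τ ∂(volume.restrict (Ioi (0:ℝ))),
      Integrable (fun x => truncFlux p β n (w (x, τ)) * g (x, τ)) (volume.restrict Ω) →
      Integrable (fun x => (∫ s in (0:ℝ)..(max (w (x, τ)) 0) ^ (1 / β), truncPow p n s) ^ 2)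
        (volume.restrict Ω) ∧
      K * c * (∫ x in Ω, (∫ s in (0:ℝ)..(max (w (x, τ)) 0) ^ (1 / β), truncPow p n s) ^ 2) ≤
        -∫ x in Ω, truncFlux p β n (w (x, τ)) * g (x, τ) := by
  filter_upwards [h.diffusion, ae_restrict_mem measurableSet_Ioi] with τ ⟨l, G, hv, hl, hdiv, hgl⟩ hτ
    hint
  have hr := continuous_truncPow (n := n) hp
  have hr2 : Continuous fun s => truncPow p n s ^ 2 := hr.pow 2
  obtain ⟨C, hC⟩ := exists_abs_truncPow_le hp n
  have hC2 : ∀ s, |truncPow p n s ^ 2| ≤ C ^ 2 := fun s => by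
    rw [abs_pow]; exact pow_le_pow_left₀ (abs_nonneg _) (hC s) 2
  have hu := h.ae_eq hβ (le_of_lt hτ)
  have hR : (fun x => (∫ s in (0:ℝ)..u x τ, truncPow p n s) ^ 2) =ᵐ[volume.restrict Ω]
      fun x => (∫ s in (0:ℝ)..(max (w (x, τ)) 0) ^ (1 / β), truncPow p n s) ^ 2 := by
    filter_upwards [hu] with x hx
    rw [hx]
  have hF : ∀ᵐ x ∂(volume.restrict Ω), truncFlux p β n (w (x, τ)) =
      ∫ s in (0:ℝ)..u x τ, truncPow p n s ^ 2 := by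
    filter_upwards [hu] with x hx
    rw [hx, truncFlux]
  refine ⟨(hv.comp hr hC).1.integrable_sq.congr hR, ?_⟩
  rw [← integral_congr_ae hR]
  have hlF : Integrable (fun x => l x * ∫ s in (0:ℝ)..u x τ, truncPow p n s ^ 2)
      (volume.restrict Ω) := hl.integrable_mul (hv.comp hr2 hC2).1
  have key := hc _ _ _ _ C hv hl hdiv hr hC
  have hle : ∫ x in Ω, truncFlux p β n (w (x, τ)) * g (x, τ) ≤
      ∫ x in Ω, K * (l x * ∫ s in (0:ℝ)..u x τ, truncPow p n s ^ 2) := by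
    refine integral_mono_ae hint (hlF.const_mul K) ?_
    filter_upwards [hF, hgl] with x hx hx2
    rw [← hx]
    -- Nonnegativity of the test function allows `g ≤ K l` to be multiplied by it.
    nlinarith [truncFlux_nonneg (p := p) (β := β) (n := n) (σ := w (x, τ))]
  rw [integral_const_mul] at hle
  nlinarith

/-- The energy inequality for truncated powers. -/
theorem truncated_energy_le [IsFiniteMeasure (volume.restrict Ω)]
    (h : IsRepresentative Ω K β u w g) (hβ : 0 < β) (hK : 0 < K)
    (hc0 : 0 ≤ c) (hc : IsDissipationConstant Ω c) (hp : 0 ≤ p) (n : ℕ) {s t : ℝ} (hs : 0 ≤ s)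
    (hst : s ≤ t)
    (hfin : Integrable (fun x => w (x, s) ^ ((2 * p + 1 + β) / β)) (volume.restrict Ω)) :
    (∫⁻ x in Ω, ENNReal.ofReal (∫ σ in (0:ℝ)..w (x, t), truncFlux p β n σ)) +
      ∫⁻ τ in Ioc s t, ∫⁻ x in Ω, ENNReal.ofReal (K * c *
        (∫ s in (0:ℝ)..(max (w (x, τ)) 0) ^ (1 / β), truncPow p n s) ^ 2) ≤
      ∫⁻ x in Ω, ENNReal.ofReal (∫ σ in (0:ℝ)..w (x, s), truncFlux p β n σ) := by
  set μ := volume.restrict Ω with hμ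
  have hcF := continuous_truncFlux (n := n) hp hβ
  obtain ⟨B, hB⟩ := exists_abs_truncFlux_le hp β n
  have hsub : Ioc s t ⊆ Ioi (0:ℝ) := fun τ hτ => lt_of_le_of_lt hs hτ.1
  have hHm : ∀ τ, Measurable fun x => ∫ σ in (0:ℝ)..w (x, τ), truncFlux p β n σ := fun τ =>
    (continuous_primitive_zero hcF).measurable.comp (h.measurable_slice τ)
  have hA : Integrable (fun x => ∫ σ in (0:ℝ)..w (x, s), truncFlux p β n σ) μ := by
    refine (hfin.const_mul (β / ((2 * p + 1 + β) * (2 * p + 1)))).mono'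
      (hHm s).aestronglyMeasurable ?_
    filter_upwards [h.ae_nonneg hs] with x hx
    rw [Real.norm_of_nonneg (integral_truncFlux_nonneg hx)]
    exact integral_truncFlux_le hp hβ hx
  have hgI : Integrable g (μ.prod (volume.restrict (Ioc s t))) := by
    have : MemLp g 2 (μ.prod (volume.restrict (Ioc s t))) :=
      h.memLp.mono_measure (Measure.prod_mono le_rfl (Measure.restrict_mono hsub le_rfl))
    exact this.integrable (by norm_num)
  have hP : Integrable (fun z => truncFlux p β n (w z) * g z)
      (μ.prod (volume.restrict (Ioc s t))) :=
    hgI.bdd_mul (c := B) (hcF.comp_aestronglyMeasurable h.stronglyMeasurable.aestronglyMeasurable)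
      (ae_of_all _ fun z => hB _)
  set D : ℝ → ℝ := fun τ => ∫ x, truncFlux p β n (w (x, τ)) * g (x, τ) ∂μ with hD
  have hDi : Integrable D (volume.restrict (Ioc s t)) := hP.integral_prod_right
  have hH : (fun x => ∫ σ in (0:ℝ)..w (x, t), truncFlux p β n σ) =ᵐ[μ] fun x =>
      (∫ σ in (0:ℝ)..w (x, s), truncFlux p β n σ) +
        ∫ τ in Ioc s t, truncFlux p β n (w (x, τ)) * g (x, τ) := by
    filter_upwards [h.primitive] with x hx
    have := integral_comp_primitive_mul (w := fun τ => w (x, τ)) hst (hx s t hs hst).1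
      (fun τ hτ => (hx s τ hs hτ.1).2) hcF hB
    rw [← intervalIntegral.integral_of_le hst, ← this]
    ring
  have hHt : Integrable (fun x => ∫ σ in (0:ℝ)..w (x, t), truncFlux p β n σ) μ :=
    (hA.add hP.integral_prod_left).congr hH.symm
  -- The chain rule in time integrated over `Ω`; the order of integration may be exchanged because
  -- the truncated flux is bounded.
  have hbal : ∫ x, (∫ σ in (0:ℝ)..w (x, t), truncFlux p β n σ) ∂μ =
      ∫ x, (∫ σ in (0:ℝ)..w (x, s), truncFlux p β n σ) ∂μ + ∫ τ in Ioc s t, D τ := by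
    rw [integral_congr_ae hH, integral_add hA hP.integral_prod_left, integral_integral_swap hP]
  have hflux := ae_restrict_of_ae_restrict_of_subset hsub (h.ae_flux_le hβ hK hc hp n)
  have hDle : ∀ᵐ τ ∂(volume.restrict (Ioc s t)), ∫⁻ x, ENNReal.ofReal (K * c *
        (∫ s in (0:ℝ)..(max (w (x, τ)) 0) ^ (1 / β), truncPow p n s) ^ 2) ∂μ ≤
        ENNReal.ofReal (-D τ) ∧ 0 ≤ -D τ := by
    filter_upwards [hflux, hP.prod_left_ae] with τ hτ hτi
    obtain ⟨h1, h2⟩ := hτ hτi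
    rw [← integral_const_mul] at h2
    rw [← ofReal_integral_eq_lintegral_ofReal (h1.const_mul _) (ae_of_all _ fun x => by positivity)]
    exact ⟨ENNReal.ofReal_le_ofReal h2, (integral_nonneg fun x => by positivity).trans h2⟩
  have hlast : ∫⁻ τ in Ioc s t, ∫⁻ x in Ω, ENNReal.ofReal (K * c *
        (∫ s in (0:ℝ)..(max (w (x, τ)) 0) ^ (1 / β), truncPow p n s) ^ 2) ≤
      ENNReal.ofReal (∫ τ in Ioc s t, -D τ) := by
    rw [ofReal_integral_eq_lintegral_ofReal (f := fun τ => -D τ) hDi.neg (hDle.mono fun τ hτ => hτ.2)]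
    exact lintegral_mono_ae (hDle.mono fun τ hτ => hτ.1)
  have hnt : 0 ≤ᵐ[μ] fun x => ∫ σ in (0:ℝ)..w (x, t), truncFlux p β n σ :=
    (h.ae_nonneg (hs.trans hst)).mono fun x hx => integral_truncFlux_nonneg hx
  have hns : 0 ≤ᵐ[μ] fun x => ∫ σ in (0:ℝ)..w (x, s), truncFlux p β n σ :=
    (h.ae_nonneg hs).mono fun x hx => integral_truncFlux_nonneg hx
  refine (add_le_add_right hlast _).trans ?_
  rw [← ofReal_integral_eq_lintegral_ofReal hHt hnt, ← ofReal_integral_eq_lintegral_ofReal hA hns,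
    ← ENNReal.ofReal_add (integral_nonneg_of_ae hnt)
      (integral_nonneg_of_ae (hDle.mono fun τ hτ => hτ.2)), hbal, integral_neg]
  simp

/-- The energy inequality, in terms of `w = u^β`. -/
theorem energy_le_aux [IsFiniteMeasure (volume.restrict Ω)]
    (h : IsRepresentative Ω K β u w g) (hβ : 0 < β) (hK : 0 < K)
    (hc0 : 0 ≤ c) (hc : IsDissipationConstant Ω c) (hp : 0 ≤ p) {s t : ℝ} (hs : 0 ≤ s)
    (hst : s ≤ t)
    (hfin : Integrable (fun x => w (x, s) ^ ((2 * p + 1 + β) / β)) (volume.restrict Ω)) :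
    (∫⁻ x in Ω, ENNReal.ofReal (β / ((2 * p + 1 + β) * (2 * p + 1)) *
        w (x, t) ^ ((2 * p + 1 + β) / β))) +
      ∫⁻ τ in Ioc s t, ∫⁻ x in Ω, ENNReal.ofReal (K * c *
        (((max (w (x, τ)) 0) ^ (1 / β)) ^ (p + 1) / (p + 1)) ^ 2) ≤
      ∫⁻ x in Ω, ENNReal.ofReal (β / ((2 * p + 1 + β) * (2 * p + 1)) *
        w (x, s) ^ ((2 * p + 1 + β) / β)) := by
  have hcF := fun n => continuous_truncFlux (n := n) hp hβ
  have hcP := fun n => continuous_primitive_zero (continuous_truncPow (n := n) hp)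
  have hwm := h.stronglyMeasurable.measurable
  -- On the left, truncated and full quantities agree pointwise for large `n`, so Fatou applies; on
  -- the right the truncated energy never exceeds the full one.
  refine ENNReal.add_le_of_le_liminf
    (lintegral_le_liminf_of_ae_le (F := fun n x => ENNReal.ofReal
      (∫ σ in (0:ℝ)..w (x, t), truncFlux p β n σ)) (fun n => ?_) ?_)
    (lintegral_le_liminf_of_ae_le (F := fun n τ => ∫⁻ x in Ω, ENNReal.ofReal (K * c *
        (∫ s in (0:ℝ)..(max (w (x, τ)) 0) ^ (1 / β), truncPow p n s) ^ 2)) (fun n => ?_) ?_)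
    fun n => (h.truncated_energy_le hβ hK hc0 hc hp n hs hst hfin).trans ?_
  · exact ((continuous_primitive_zero (hcF n)).measurable.comp (h.measurable_slice t)).ennreal_ofReal
  · filter_upwards [h.ae_nonneg (hs.trans hst)] with x hx
    refine le_liminf_of_eventually_eq ?_
    filter_upwards [eventually_ge_atTop ⌈w (x, t) ^ (1 / β)⌉₊] with n hn
    rw [integral_truncFlux_eq hp hβ hx (Nat.ceil_le.1 hn)]
  · have hm : Measurable fun z => ENNReal.ofReal (K * c *
        (∫ s in (0:ℝ)..(max (w z) 0) ^ (1 / β), truncPow p n s) ^ 2) :=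
      ((((hcP n).measurable.comp ((hwm.max measurable_const).pow_const _)).pow_const 2).const_mul
        _).ennreal_ofReal
    exact hm.lintegral_prod_left'
  · refine ae_of_all _ fun τ => lintegral_le_liminf_of_ae_le (fun n => ?_) (ae_of_all _ fun x => ?_)
    · exact ((((hcP n).measurable.comp (((h.measurable_slice τ).max measurable_const).pow_const
        _)).pow_const 2).const_mul _).ennreal_ofReal
    · refine le_liminf_of_eventually_eq ?_
      filter_upwards [eventually_ge_atTop ⌈(max (w (x, τ)) 0) ^ (1 / β)⌉₊] with n hn
      rw [integral_truncPow_eq hp (by positivity) (Nat.ceil_le.1 hn)]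
  · refine lintegral_mono_ae ?_
    filter_upwards [h.ae_nonneg hs] with x hx
    exact ENNReal.ofReal_le_ofReal (integral_truncFlux_le hp hβ hx)

end IsRepresentative

/-- The energy `∫_Ω u(x,t)^m dx` as an extended nonnegative number. -/
noncomputable def lenergy {N : ℕ} (Ω : Set (Space N)) (m : ℝ) (u : Space N → ℝ → ℝ) (t : ℝ) :
    ENNReal :=
  ∫⁻ x in Ω, ENNReal.ofReal (u x t ^ m)

namespace IsRepresentative

variable {N : ℕ} {Ω : Set (Space N)} {K β c m : ℝ} {u : Space N → ℝ → ℝ} {w g : Space N × ℝ → ℝ}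

theorem integrable_rpow_iff (h : IsRepresentative Ω K β u w g) (hβ : 0 < β) {t : ℝ} (ht : 0 ≤ t) :
    Integrable (fun x => u x t ^ m) (volume.restrict Ω) ↔ lenergy Ω m u t ≠ ⊤ := by
  have hm : AEStronglyMeasurable (fun x => u x t ^ m) (volume.restrict Ω) :=
    ((h.aestronglyMeasurable hβ ht).aemeasurable.pow_const m).aestronglyMeasurable
  have hn : 0 ≤ᵐ[volume.restrict Ω] fun x => u x t ^ m :=
    (h.nonneg t ht).mono fun _ hx => Real.rpow_nonneg hx m
  exact (lintegral_ofReal_ne_top_iff_integrable hm hn).symm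

theorem energy_eq (h : IsRepresentative Ω K β u w g) (hβ : 0 < β) {t : ℝ} (ht : 0 ≤ t) :
    energy Ω m u t = (lenergy Ω m u t).toReal :=
  integral_eq_lintegral_of_nonneg_ae ((h.nonneg t ht).mono fun _ hx => Real.rpow_nonneg hx m)
    ((h.aestronglyMeasurable hβ ht).aemeasurable.pow_const m).aestronglyMeasurable

/-- The energy inequality. -/
theorem lenergy_add_le [IsFiniteMeasure (volume.restrict Ω)]
    (h : IsRepresentative Ω K β u w g) (hβ : 0 < β) (hK : 0 < K)
    (hc0 : 0 < c) (hc : IsDissipationConstant Ω c) (hm : 1 + β ≤ m) {s t : ℝ} (hs : 0 ≤ s)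
    (hst : s ≤ t) :
    lenergy Ω m u t + ENNReal.ofReal (4 * K * c * m * (m - β) / (β * (m + 1 - β) ^ 2)) *
      ∫⁻ τ in Ioc s t, lenergy Ω (m + (1 - β)) u τ ≤ lenergy Ω m u s := by
  by_cases htop : lenergy Ω m u s = ⊤
  · rw [htop]; exact le_top
  -- Chosen so that the primitive of `s^(2p)` is `s^(m-β)/(m-β)`.
  set p : ℝ := (m - β - 1) / 2 with hpdef
  have hp : 0 ≤ p := by rw [hpdef]; linarith
  have hm0 : 0 < m := by linarith
  have e1 : 2 * p + 1 + β = m := by rw [hpdef]; ring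
  have e2 : 2 * p + 1 = m - β := by rw [hpdef]; ring
  have hw : ∀ τ, 0 ≤ τ → ∀ᵐ x ∂(volume.restrict Ω), w (x, τ) ^ (m / β) = u x τ ^ m := by
    intro τ hτ
    filter_upwards [h.eq_rpow τ hτ, h.nonneg τ hτ] with x hx hx0
    rw [hx, ← Real.rpow_mul hx0, mul_div_cancel₀ _ hβ.ne']
  have hfin : Integrable (fun x => w (x, s) ^ ((2 * p + 1 + β) / β)) (volume.restrict Ω) := by
    rw [e1]
    exact ((h.integrable_rpow_iff hβ hs).2 htop).congr ((hw s hs).mono fun x hx => hx.symm)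
  have key := h.energy_le_aux hβ hK hc0.le hc hp hs hst hfin
  rw [e1, e2] at key
  set b : ℝ := β / (m * (m - β)) with hb
  have hb0 : 0 < b := div_pos hβ (mul_pos hm0 (by linarith))
  have hE : ∀ τ, 0 ≤ τ → ∫⁻ x in Ω, ENNReal.ofReal (b * w (x, τ) ^ (m / β)) =
      ENNReal.ofReal b * lenergy Ω m u τ := by
    intro τ hτ
    rw [lenergy, ← lintegral_const_mul' _ _ ENNReal.ofReal_ne_top]
    refine lintegral_congr_ae ?_
    filter_upwards [hw τ hτ] with x hx
    rw [hx, ENNReal.ofReal_mul hb0.le]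
  have hD : ∫⁻ τ in Ioc s t, ∫⁻ x in Ω, ENNReal.ofReal (K * c *
        (((max (w (x, τ)) 0) ^ (1 / β)) ^ (p + 1) / (p + 1)) ^ 2) =
      ENNReal.ofReal (K * c / (p + 1) ^ 2) * ∫⁻ τ in Ioc s t, lenergy Ω (m + (1 - β)) u τ := by
    rw [← lintegral_const_mul' _ _ ENNReal.ofReal_ne_top]
    refine setLIntegral_congr_fun measurableSet_Ioc fun τ hτ => ?_
    have hτ0 : 0 ≤ τ := hs.trans hτ.1.le
    simp only [lenergy]
    rw [← lintegral_const_mul' _ _ ENNReal.ofReal_ne_top]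
    refine lintegral_congr_ae ?_
    filter_upwards [h.ae_eq hβ hτ0, h.nonneg τ hτ0] with x hx hx0
    rw [← hx, ← ENNReal.ofReal_mul (by positivity), div_pow, ← Real.rpow_natCast, ← Real.rpow_mul hx0]
    congr 1
    rw [show (p + 1) * ((2 : ℕ) : ℝ) = m + (1 - β) by rw [hpdef]; push_cast; ring]
    ring
  rw [hE t (hs.trans hst), hE s hs, hD] at key
  -- The factor `b` of the energy density is divided out, leaving `κ = K c / (b (p+1)²)`.
  have hk : K * c / (p + 1) ^ 2 = b * (4 * K * c * m * (m - β) / (β * (m + 1 - β) ^ 2)) := by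
    have h1 : m - β ≠ 0 := by linarith
    have h2 : p + 1 = (m + 1 - β) / 2 := by rw [hpdef]; ring
    have h3 : m + 1 - β ≠ 0 := by linarith
    rw [h2, hb]
    field_simp
    norm_num
  rw [hk, ENNReal.ofReal_mul hb0.le, mul_assoc, ← mul_add] at key
  exact (ENNReal.mul_le_mul_iff_right (by simpa using hb0) ENNReal.ofReal_ne_top).1 key

end IsRepresentative

/-! ### Elementary inequalities for powers. -/

theorem rpow_le_one_add_rpow {x q r : ℝ} (hx : 0 ≤ x) (hq : 0 ≤ q) (hqr : q ≤ r) :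
    x ^ q ≤ 1 + x ^ r := by
  rcases le_total x 1 with h | h
  · linarith [Real.rpow_le_one hx h hq, Real.rpow_nonneg hx r]
  · linarith [Real.rpow_le_rpow_of_exponent_le h hqr]

/-- Bernoulli's inequality for `B / A = 1 + (B / A - 1)`, multiplied by `A ^ P`. -/
theorem rpow_sub_rpow_le {A B P : ℝ} (hB : 0 ≤ B) (hBA : B ≤ A) (hP : 1 ≤ P) :
    A ^ P - B ^ P ≤ P * A ^ (P - 1) * (A - B) := by
  rcases (hB.trans hBA).eq_or_lt with hA | hA
  · have : B = 0 := by linarith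
    simp [← hA, this]
  have h1 := one_add_mul_self_le_rpow_one_add (s := B / A - 1) (p := P)
    (by have : 0 ≤ B / A := by positivity
        linarith) hP
  rw [add_sub_cancel, Real.div_rpow hB hA.le] at h1
  have h2 := mul_le_mul_of_nonneg_left h1 (Real.rpow_nonneg hA.le P)
  rw [mul_div_cancel₀ _ (Real.rpow_pos_of_pos hA P).ne'] at h2
  have h3 : A ^ P = A ^ (P - 1) * A := by
    rw [← Real.rpow_add_one hA.ne']; congr 1; ring
  have h4 : A ^ P * (1 + P * (B / A - 1)) = A ^ P - P * A ^ (P - 1) * (A - B) := by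
    rw [h3]; field_simp; ring
  linarith

theorem abs_rpow_sub_rpow_le {A B P : ℝ} (hA : 0 ≤ A) (hB : 0 ≤ B) (hP : 1 ≤ P) :
    |A ^ P - B ^ P| ≤ P * (A ^ (P - 1) + B ^ (P - 1)) * |A - B| := by
  have hA' : 0 ≤ A ^ (P - 1) := Real.rpow_nonneg hA _
  have hB' : 0 ≤ B ^ (P - 1) := Real.rpow_nonneg hB _
  wlog h : B ≤ A generalizing A B
  · rw [abs_sub_comm, abs_sub_comm A, add_comm]
    exact this hB hA hB' hA' (not_le.1 h).le
  rw [abs_of_nonneg (sub_nonneg.2 (Real.rpow_le_rpow hB h (by linarith))),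
    abs_of_nonneg (sub_nonneg.2 h)]
  refine (rpow_sub_rpow_le hB h hP).trans ?_
  have : 0 ≤ A - B := sub_nonneg.2 h
  gcongr
  linarith

/-! ### Monotonicity, gain of integrability, decay and continuity of the energy. -/

namespace IsRepresentative

variable {N : ℕ} {Ω : Set (Space N)} {K β c m : ℝ} {u : Space N → ℝ → ℝ} {w g : Space N × ℝ → ℝ}

theorem lenergy_anti [IsFiniteMeasure (volume.restrict Ω)]
    (h : IsRepresentative Ω K β u w g) (hβ : 0 < β) (hK : 0 < K)
    (hc0 : 0 < c) (hc : IsDissipationConstant Ω c) (hm : 1 + β ≤ m) {s t : ℝ} (hs : 0 ≤ s)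
    (hst : s ≤ t) : lenergy Ω m u t ≤ lenergy Ω m u s :=
  le_self_add.trans (h.lenergy_add_le hβ hK hc0 hc hm hs hst)

/-- The solution instantly gains integrability. -/
theorem lenergy_ne_top_of_lt [IsFiniteMeasure (volume.restrict Ω)]
    (h : IsRepresentative Ω K β u w g) (hβ : 0 < β) (hβ1 : β < 1) (hK : 0 < K)
    (hc0 : 0 < c) (hc : IsDissipationConstant Ω c) (hm : 1 + β ≤ m) {t₀ : ℝ} (ht₀ : 0 ≤ t₀)
    (hfin : lenergy Ω m u t₀ ≠ ⊤) (k : ℕ) {t : ℝ} (ht : t₀ < t) :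
    lenergy Ω (m + k * (1 - β)) u t ≠ ⊤ := by
  induction k generalizing t with
  | zero =>
    simpa using ne_top_of_le_ne_top hfin (h.lenergy_anti hβ hK hc0 hc hm ht₀ ht.le)
  | succ k ih =>
    have hm' : 1 + β ≤ m + k * (1 - β) := by
      have : 0 ≤ (k : ℝ) * (1 - β) := mul_nonneg k.cast_nonneg (by linarith)
      linarith
    have hst : t₀ < (t₀ + t) / 2 := by linarith
    have hst' : (t₀ + t) / 2 < t := by linarith
    have key := h.lenergy_add_le hβ hK hc0 hc hm' (ht₀.trans hst.le) hst'.le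
    have hsucc : m + ((k + 1 : ℕ) : ℝ) * (1 - β) = m + k * (1 - β) + (1 - β) := by
      push_cast; ring
    rw [hsucc]
    intro htop
    -- Every energy decreases, so an infinite value at `t` would be infinite on the whole second
    -- half of `(t₀, t]`, contradicting the finite dissipation there.
    have hall : ∀ τ ∈ Ioc ((t₀ + t) / 2) t, lenergy Ω (m + k * (1 - β) + (1 - β)) u τ = ⊤ := by
      intro τ hτ
      have := h.lenergy_anti hβ hK hc0 hc (m := m + k * (1 - β) + (1 - β)) (by linarith)
        ((ht₀.trans hst.le).trans hτ.1.le) hτ.2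
      exact top_le_iff.1 (htop ▸ this)
    rw [setLIntegral_congr_fun measurableSet_Ioc hall, setLIntegral_const, Real.volume_Ioc,
      ENNReal.top_mul (by simpa using hst'), ENNReal.mul_top] at key
    · exact ih hst (top_le_iff.1 (le_trans (by simp) key))
    · have h1 : 0 < m + k * (1 - β) - β := by linarith
      have h2 : 0 < m + k * (1 - β) := by linarith
      have h3 : 0 < m + k * (1 - β) + 1 - β := by linarith
      simp only [ne_eq, ENNReal.ofReal_eq_zero, not_le]
      positivity

theorem lenergy_le_of_le (h : IsRepresentative Ω K β u w g) {q r : ℝ} (hq : 0 ≤ q) (hqr : q ≤ r)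
    {t : ℝ} (ht : 0 ≤ t) : lenergy Ω q u t ≤ volume Ω + lenergy Ω r u t := by
  rw [lenergy, lenergy, ← setLIntegral_one, ← lintegral_add_left measurable_const]
  refine lintegral_mono_ae ?_
  filter_upwards [h.nonneg t ht] with x hx
  rw [← ENNReal.ofReal_one, ← ENNReal.ofReal_add zero_le_one (Real.rpow_nonneg hx _)]
  exact ENNReal.ofReal_le_ofReal (rpow_le_one_add_rpow hx hq hqr)

/-- Hölder's inequality between energies of different order. -/
theorem lenergy_rpow_le (h : IsRepresentative Ω K β u w g) (hβ : 0 < β) {θ : ℝ} (hθ : 0 < θ)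
    {t : ℝ} (ht : 0 ≤ t) :
    lenergy Ω m u t ^ (1 + θ) ≤ volume Ω ^ θ * lenergy Ω (m * (1 + θ)) u t := by
  have hpq : (1 + θ).HolderConjugate ((1 + θ) / θ) := by
    rw [Real.holderConjugate_iff]
    refine ⟨by linarith, ?_⟩
    field_simp
  have hmeas : AEMeasurable (fun x => ENNReal.ofReal (u x t ^ m)) (volume.restrict Ω) :=
    ((h.aestronglyMeasurable hβ ht).aemeasurable.pow_const m).ennreal_ofReal
  have key := ENNReal.lintegral_mul_le_Lp_mul_Lq (volume.restrict Ω) hpq hmeas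
    (aemeasurable_const (b := (1 : ENNReal)))
  have hpow : ∫⁻ x in Ω, ENNReal.ofReal (u x t ^ m) ^ (1 + θ) = lenergy Ω (m * (1 + θ)) u t := by
    refine lintegral_congr_ae ?_
    filter_upwards [h.nonneg t ht] with x hx
    rw [ENNReal.ofReal_rpow_of_nonneg (Real.rpow_nonneg hx _) (by positivity), Real.rpow_mul hx]
  simp only [Pi.mul_apply, mul_one, ENNReal.one_rpow, lintegral_const, one_mul,
    Measure.restrict_apply_univ] at key
  rw [hpow] at key
  refine (ENNReal.rpow_le_rpow key (by positivity : 0 ≤ 1 + θ)).trans (le_of_eq ?_)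
  rw [ENNReal.mul_rpow_of_nonneg _ _ (by positivity), ← ENNReal.rpow_mul, ← ENNReal.rpow_mul,
    one_div_mul_cancel (by positivity), ENNReal.rpow_one, mul_comm]
  congr 2
  field_simp

/-- The energy inequality in closed form. -/
theorem energy_add_le [IsFiniteMeasure (volume.restrict Ω)]
    (h : IsRepresentative Ω K β u w g) (hβ : 0 < β) (hβ1 : β < 1) (hK : 0 < K)
    (hc0 : 0 < c) (hc : IsDissipationConstant Ω c) (hm : 1 + β ≤ m) {s t : ℝ} (hs : 0 ≤ s)
    (hst : s ≤ t) (hfin : lenergy Ω m u s ≠ ⊤) :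
    energy Ω m u t + 4 * K * c * m * (m - β) / (β * (m + 1 - β) ^ 2) /
      ((volume Ω).toReal + 1) ^ ((1 - β) / m) * (t - s) * energy Ω m u t ^ (1 + (1 - β) / m) ≤
      energy Ω m u s := by
  have hm0 : 0 < m := by linarith
  have hθ : 0 < (1 - β) / m := div_pos (by linarith) hm0
  have ht := hs.trans hst
  set κ := 4 * K * c * m * (m - β) / (β * (m + 1 - β) ^ 2) with hκ
  have hκ0 : 0 < κ := by
    have h1 : 0 < m - β := by linarith
    have h3 : 0 < m + 1 - β := by linarith
    positivity
  have hvol : volume Ω ≠ ⊤ := by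
    have := measure_ne_top (volume.restrict Ω) univ
    rwa [Measure.restrict_apply_univ] at this
  -- The added `1` keeps the base positive even when `Ω` is empty.
  set v := (volume Ω).toReal + 1 with hv
  have hv0 : 0 < v := by positivity
  have hvle : volume Ω ≤ ENNReal.ofReal v := by
    rw [← ENNReal.ofReal_toReal hvol]; exact ENNReal.ofReal_le_ofReal (by linarith)
  have htfin : lenergy Ω m u t ≠ ⊤ := ne_top_of_le_ne_top hfin (h.lenergy_anti hβ hK hc0 hc hm hs hst)
  set y := energy Ω m u t with hy
  have hy0 : 0 ≤ y := by rw [hy, h.energy_eq hβ ht]; exact ENNReal.toReal_nonneg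
  have hyE : lenergy Ω m u t = ENNReal.ofReal y := by
    rw [hy, h.energy_eq hβ ht, ENNReal.ofReal_toReal htfin]
  have hsE : lenergy Ω m u s = ENNReal.ofReal (energy Ω m u s) := by
    rw [h.energy_eq hβ hs, ENNReal.ofReal_toReal hfin]
  -- Since the energy decreases, its value at the right end `t` bounds the dissipation below
  -- throughout `(s, t]`.
  have hlow : ∀ τ ∈ Ioc s t, ENNReal.ofReal (y ^ (1 + (1 - β) / m) / v ^ ((1 - β) / m)) ≤
      lenergy Ω (m + (1 - β)) u τ := by
    intro τ hτ
    have hτ0 := hs.trans hτ.1.le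
    have h1 := h.lenergy_rpow_le (m := m) hβ hθ hτ0
    rw [show m * (1 + (1 - β) / m) = m + (1 - β) by field_simp] at h1
    have h2 : ENNReal.ofReal y ^ (1 + (1 - β) / m) ≤
        ENNReal.ofReal v ^ ((1 - β) / m) * lenergy Ω (m + (1 - β)) u τ := by
      refine (ENNReal.rpow_le_rpow ?_ (by positivity)).trans (h1.trans (by gcongr))
      rw [← hyE]
      exact h.lenergy_anti hβ hK hc0 hc hm hτ0 hτ.2
    rw [ENNReal.ofReal_rpow_of_nonneg hy0 (by positivity), ENNReal.ofReal_rpow_of_pos hv0] at h2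
    rw [ENNReal.ofReal_div_of_pos (by positivity)]
    exact ENNReal.div_le_of_le_mul' h2
  have hint : ENNReal.ofReal (y ^ (1 + (1 - β) / m) / v ^ ((1 - β) / m)) * ENNReal.ofReal (t - s) ≤
      ∫⁻ τ in Ioc s t, lenergy Ω (m + (1 - β)) u τ := by
    rw [← Real.volume_Ioc, ← setLIntegral_const]
    exact setLIntegral_mono' measurableSet_Ioc hlow
  have key := (add_le_add_right (mul_le_mul_right hint _) _).trans
    (h.lenergy_add_le hβ hK hc0 hc hm hs hst)
  have hts : 0 ≤ t - s := sub_nonneg.2 hst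
  rw [hyE, hsE, ← hκ, ← ENNReal.ofReal_mul (by positivity), ← ENNReal.ofReal_mul hκ0.le,
    ← ENNReal.ofReal_add hy0 (by positivity), ENNReal.ofReal_le_ofReal_iff] at key
  · refine le_trans (le_of_eq ?_) key
    ring
  · rw [h.energy_eq hβ hs]; exact ENNReal.toReal_nonneg

/-- The energy is continuous in time, from the right. -/
theorem tendsto_energy_nhdsGT [IsFiniteMeasure (volume.restrict Ω)]
    (h : IsRepresentative Ω K β u w g) (hβ : 0 < β) (hK : 0 < K)
    (hc0 : 0 < c) (hc : IsDissipationConstant Ω c) (hm : 1 + β ≤ m) {t₀ : ℝ} (ht₀ : 0 ≤ t₀)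
    (hfin : lenergy Ω m u t₀ ≠ ⊤) :
    Tendsto (energy Ω m u) (𝓝[>] t₀) (𝓝 (energy Ω m u t₀)) := by
  have hm0 : 0 < m := by linarith
  set τ : ℕ → ℝ := fun n => t₀ + 1 / ((n : ℝ) + 1) with hτ
  have hτgt : ∀ n, t₀ < τ n := fun n => by
    have : 0 < 1 / ((n : ℝ) + 1) := by positivity
    simp only [hτ]; linarith
  have hτlim : Tendsto τ atTop (𝓝 t₀) := by
    simpa [hτ] using (tendsto_one_div_add_atTop_nhds_zero_nat (𝕜 := ℝ)).const_add t₀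
  -- Fatou's lemma along one sequence suffices: monotonicity carries the lower bound from a single
  -- `τ n` to all of `(t₀, τ n)`.
  have hlsc : lenergy Ω m u t₀ ≤ liminf (fun n => lenergy Ω m u (τ n)) atTop := by
    have hV : ∀ t, 0 ≤ t → lenergy Ω m u t =
        ∫⁻ x in Ω, ENNReal.ofReal (((max (w (x, t)) 0) ^ (1 / β)) ^ m) := fun t ht =>
      lintegral_congr_ae ((h.ae_eq hβ ht).mono fun x hx => by simp only [hx])
    rw [hV t₀ ht₀]
    simp_rw [fun n => hV (τ n) (ht₀.trans (hτgt n).le)]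
    refine lintegral_le_liminf_of_ae_le (fun n => ?_) ?_
    · exact ((((h.measurable_slice _).max measurable_const).pow_const _).pow_const _).ennreal_ofReal
    · filter_upwards [h.primitive] with x hx
      have hcont : Tendsto (fun n => w (x, τ n)) atTop (𝓝 (w (x, t₀))) := by
        have hp := (hx t₀ (t₀ + 1) ht₀ (by linarith)).1.absolutelyContinuousOnInterval_intervalIntegral
          (c := t₀) left_mem_uIcc |>.continuousOn t₀ left_mem_uIcc
        have hmem : ∀ n, τ n ∈ uIcc t₀ (t₀ + 1) := fun n => by
          rw [uIcc_of_le (by linarith)]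
          refine ⟨(hτgt n).le, ?_⟩
          have : 1 / ((n : ℝ) + 1) ≤ 1 := by
            rw [div_le_one (by positivity)]; linarith [n.cast_nonneg (α := ℝ)]
          simp only [hτ]; linarith
        have h2 := (hp.tendsto.comp (tendsto_nhdsWithin_iff.2
          ⟨hτlim, Eventually.of_forall hmem⟩)).const_add (w (x, t₀))
        simp only [intervalIntegral.integral_same, add_zero] at h2
        exact h2.congr fun n => (hx t₀ (τ n) ht₀ (hτgt n).le).2.symm
      have hlim : Tendsto (fun n => ENNReal.ofReal (((max (w (x, τ n)) 0) ^ (1 / β)) ^ m)) atTop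
          (𝓝 (ENNReal.ofReal (((max (w (x, t₀)) 0) ^ (1 / β)) ^ m))) :=
        ENNReal.tendsto_ofReal (((hcont.max tendsto_const_nhds).rpow_const
          (Or.inr (by positivity))).rpow_const (Or.inr hm0.le))
      exact hlim.liminf_eq.ge
  have hE : ∀ t, t₀ ≤ t → lenergy Ω m u t = ENNReal.ofReal (energy Ω m u t) := fun t ht => by
    rw [h.energy_eq hβ (ht₀.trans ht), ENNReal.ofReal_toReal
      (ne_top_of_le_ne_top hfin (h.lenergy_anti hβ hK hc0 hc hm ht₀ ht))]
  have hnn : ∀ t, t₀ ≤ t → 0 ≤ energy Ω m u t := fun t ht => by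
    rw [h.energy_eq hβ (ht₀.trans ht)]; exact ENNReal.toReal_nonneg
  have hanti : ∀ s t, t₀ ≤ s → s ≤ t → energy Ω m u t ≤ energy Ω m u s := fun s t hs hst => by
    rw [← ENNReal.ofReal_le_ofReal_iff (hnn s hs), ← hE s hs, ← hE t (hs.trans hst)]
    exact h.lenergy_anti hβ hK hc0 hc hm (ht₀.trans hs) hst
  refine tendsto_order.2 ⟨fun a ha => ?_, fun b hb => ?_⟩
  · rcases lt_or_ge a 0 with ha0 | ha0
    · filter_upwards [self_mem_nhdsWithin] with t ht
      exact ha0.trans_le (hnn t (le_of_lt ht))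
    have h1 : ENNReal.ofReal a < lenergy Ω m u t₀ := by
      rw [hE t₀ le_rfl]
      exact (ENNReal.ofReal_lt_ofReal_iff_of_nonneg ha0).2 ha
    obtain ⟨n, hn⟩ := (eventually_lt_of_lt_liminf (h1.trans_le hlsc)).exists
    rw [hE _ (hτgt n).le, ENNReal.ofReal_lt_ofReal_iff_of_nonneg ha0] at hn
    filter_upwards [Ioo_mem_nhdsGT (hτgt n)] with t ht
    exact hn.trans_le (hanti t _ ht.1.le ht.2.le)
  · filter_upwards [self_mem_nhdsWithin] with t ht
    exact (hanti t₀ t le_rfl (le_of_lt ht)).trans_lt hb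

/-- The energy is absolutely continuous away from the initial time. -/
theorem absolutelyContinuousOnInterval_energy_of_lt [IsFiniteMeasure (volume.restrict Ω)]
    (h : IsRepresentative Ω K β u w g) (hβ : 0 < β) (hβ1 : β < 1) (hK : 0 < K)
    (hc0 : 0 < c) (hc : IsDissipationConstant Ω c) (hm : 1 + β ≤ m) {t₀ : ℝ} (ht₀ : 0 ≤ t₀)
    (hfin : lenergy Ω m u t₀ ≠ ⊤) {t₁ T : ℝ} (ht₁ : t₀ < t₁) (hT : t₁ ≤ T) :
    AbsolutelyContinuousOnInterval (energy Ω m u) t₁ T := by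
  have hm0 : 0 < m := by linarith
  have ht₁0 : 0 < t₁ := ht₀.trans_lt ht₁
  have ha : 0 ≤ 2 * (m - β) := by linarith
  -- Enough iterations to reach the exponent `2(m-β)`, which is what `u^(m-β) ∈ L²` requires.
  obtain ⟨k, hk⟩ := exists_nat_ge (2 * (m - β) / (1 - β))
  have hk' : 2 * (m - β) ≤ m + k * (1 - β) := by
    rw [div_le_iff₀ (by linarith)] at hk; linarith
  have hm' : 1 + β ≤ m + k * (1 - β) := by
    have : 0 ≤ (k : ℝ) * (1 - β) := mul_nonneg k.cast_nonneg (by linarith)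
    linarith
  have hvol : volume Ω ≠ ⊤ := by
    have := measure_ne_top (volume.restrict Ω) univ
    rwa [Measure.restrict_apply_univ] at this
  set M := (volume Ω + lenergy Ω (m + k * (1 - β)) u t₁).toReal with hM
  have hMtop : volume Ω + lenergy Ω (m + k * (1 - β)) u t₁ ≠ ⊤ :=
    ENNReal.add_ne_top.2 ⟨hvol, h.lenergy_ne_top_of_lt hβ hβ1 hK hc0 hc hm ht₀ hfin k ht₁⟩
  have hbd : ∀ t, t₁ ≤ t → lenergy Ω (2 * (m - β)) u t ≤
      volume Ω + lenergy Ω (m + k * (1 - β)) u t₁ := fun t ht =>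
    (h.lenergy_le_of_le ha hk' (ht₁0.le.trans ht)).trans
      (add_le_add_right (h.lenergy_anti hβ hK hc0 hc hm' ht₁0.le ht) _)
  have hi2 : ∀ t, t₁ ≤ t → Integrable (fun x => u x t ^ (2 * (m - β))) (volume.restrict Ω) :=
    fun t ht => (h.integrable_rpow_iff hβ (ht₁0.le.trans ht)).2
      (ne_top_of_le_ne_top hMtop (hbd t ht))
  have hE2 : ∀ t, t₁ ≤ t → ∫ x in Ω, u x t ^ (2 * (m - β)) ≤ M := fun t ht => by
    have := h.energy_eq (m := 2 * (m - β)) hβ (ht₁0.le.trans ht)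
    rw [energy] at this
    rw [this]
    exact ENNReal.toReal_mono hMtop (hbd t ht)
  have him : ∀ t, t₁ ≤ t → Integrable (fun x => u x t ^ m) (volume.restrict Ω) := fun t ht =>
    (h.integrable_rpow_iff hβ (ht₁0.le.trans ht)).2
      (ne_top_of_le_ne_top hfin (h.lenergy_anti hβ hK hc0 hc hm ht₀ (ht₁.le.trans ht)))
  have hM0 : 0 ≤ M := ENNReal.toReal_nonneg
  have hsq : Integrable (fun z => g z ^ 2)
      ((volume.restrict Ω).prod (volume.restrict (Ioi (0 : ℝ)))) := h.memLp.integrable_sq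
  set q : ℝ → ℝ := fun τ => ∫ x in Ω, g (x, τ) ^ 2 with hq
  have hqi : Integrable q (volume.restrict (Ioi (0 : ℝ))) := hsq.integral_prod_right
  have hsub : ∀ s t, 0 ≤ s → Ioc s t ⊆ Ioi (0 : ℝ) := fun s t hs τ hτ => lt_of_le_of_lt hs hτ.1
  have hqI : ∀ s t, 0 ≤ s → s ≤ t → IntervalIntegrable q volume s t := fun s t hs hst => by
    rw [intervalIntegrable_iff_integrableOn_Ioc_of_le hst]
    exact hqi.mono_measure (Measure.restrict_mono (hsub s t hs) le_rfl)
  -- The majorant: `1` accounts for the bounded energies of order `2(m-β)`, and `q` for `‖w_t‖²` in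
  -- `L²(Ω)`.
  have hψ : AbsolutelyContinuousOnInterval (fun τ => ∫ σ in t₁..τ, (1 + q σ)) t₁ T :=
    ((intervalIntegrable_const (c := (1:ℝ))).add
      (hqI t₁ T ht₁0.le hT)).absolutelyContinuousOnInterval_intervalIntegral left_mem_uIcc
  have hmain : ∀ s t, t₁ ≤ s → s ≤ t → |energy Ω m u t - energy Ω m u s| ≤
      m / β * (4 * M + 1) * ∫ σ in s..t, (1 + q σ) := by
    intro s t hs hst
    have hs0 : 0 ≤ s := ht₁0.le.trans hs
    have hsqst : Integrable (fun z => g z ^ 2)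
        ((volume.restrict Ω).prod (volume.restrict (Ioc s t))) :=
      hsq.mono_measure (Measure.prod_mono le_rfl (Measure.restrict_mono (hsub s t hs0) le_rfl))
    have hpt : ∀ᵐ x ∂(volume.restrict Ω), ‖u x t ^ m - u x s ^ m‖ ≤
        m / β * ((t - s) * (2 * (u x t ^ (2 * (m - β)) + u x s ^ (2 * (m - β)))) +
          ∫ τ in Ioc s t, g (x, τ) ^ 2) := by
      filter_upwards [h.primitive, h.nonneg s hs0, h.nonneg t (hs0.trans hst), h.eq_rpow s hs0,
        h.eq_rpow t (hs0.trans hst), hsqst.prod_right_ae] with x hx hus hut hws hwt hxsq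
      obtain ⟨hgi, hwst⟩ := hx s t hs0 hst
      have hP : 1 ≤ m / β := by rw [le_div_iff₀ hβ]; linarith
      have hpow : ∀ y : ℝ, 0 ≤ y → (y ^ β) ^ (m / β) = y ^ m ∧
          (y ^ β) ^ (m / β - 1) = y ^ (m - β) := fun y hy => by
        rw [← Real.rpow_mul hy, ← Real.rpow_mul hy]
        constructor <;> congr 1 <;> field_simp
      have h1 := abs_rpow_sub_rpow_le (Real.rpow_nonneg hut β) (Real.rpow_nonneg hus β) hP
      rw [(hpow _ hut).1, (hpow _ hus).1, (hpow _ hut).2, (hpow _ hus).2, ← hws, ← hwt, hwst,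
        add_sub_cancel_left] at h1
      set V := u x t ^ (m - β) + u x s ^ (m - β) with hV
      have hV0 : 0 ≤ V := add_nonneg (Real.rpow_nonneg hut _) (Real.rpow_nonneg hus _)
      have hVsq : V ^ 2 ≤ 2 * (u x t ^ (2 * (m - β)) + u x s ^ (2 * (m - β))) := by
        rw [mul_comm 2 (m - β), Real.rpow_mul hut, Real.rpow_mul hus, Real.rpow_ofNat,
          Real.rpow_ofNat]
        exact add_sq_le
      -- Young's inequality `V|g| ≤ V² + g²` separates the value of `u` at the two end times from
      -- the time derivative, so no product has to be integrated over `Ω`.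
      have h2 : V * |∫ τ in s..t, g (x, τ)| ≤ (t - s) * V ^ 2 + ∫ τ in Ioc s t, g (x, τ) ^ 2 := by
        have hgi' := (intervalIntegrable_iff_integrableOn_Ioc_of_le hst).1 hgi
        calc V * |∫ τ in s..t, g (x, τ)| ≤ V * ∫ τ in Ioc s t, |g (x, τ)| := by
              rw [intervalIntegral.integral_of_le hst]
              gcongr
              exact abs_integral_le_integral_abs
          _ = ∫ τ in Ioc s t, V * |g (x, τ)| := (integral_const_mul _ _).symm
          _ ≤ ∫ τ in Ioc s t, (V ^ 2 + g (x, τ) ^ 2) := by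
              refine integral_mono (hgi'.abs.const_mul V) ((integrable_const _).add hxsq) fun τ => ?_
              have := sq_abs (g (x, τ))
              simp only []
              nlinarith [sq_nonneg (V - |g (x, τ)|), sq_nonneg V, sq_nonneg (g (x, τ))]
          _ = _ := by
              rw [integral_add (integrable_const _) hxsq]
              simp [hst]
      rw [Real.norm_eq_abs]
      refine h1.trans ?_
      rw [mul_assoc]
      have hts : 0 ≤ t - s := sub_nonneg.2 hst
      gcongr
      refine h2.trans ?_
      gcongr
    have hI1 : Integrable (fun x => (t - s) * (2 * (u x t ^ (2 * (m - β)) +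
        u x s ^ (2 * (m - β))))) (volume.restrict Ω) :=
      (((hi2 t (hs.trans hst)).add (hi2 s hs)).const_mul 2).const_mul _
    have hI2 : Integrable (fun x => ∫ τ in Ioc s t, g (x, τ) ^ 2) (volume.restrict Ω) :=
      hsqst.integral_prod_left
    have hts : 0 ≤ t - s := sub_nonneg.2 hst
    rw [energy, energy, ← integral_sub (him t (hs.trans hst)) (him s hs), ← Real.norm_eq_abs]
    refine (norm_integral_le_of_norm_le ((hI1.add hI2).const_mul (m / β)) hpt).trans ?_
    rw [integral_const_mul, mul_assoc]
    refine mul_le_mul_of_nonneg_left ?_ (by positivity)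
    have hq0 : 0 ≤ ∫ τ in Ioc s t, q τ :=
      integral_nonneg fun τ => integral_nonneg fun x => sq_nonneg _
    simp only [Pi.add_apply]
    rw [integral_add hI1 hI2, integral_const_mul, integral_const_mul,
      integral_add (hi2 t (hs.trans hst)) (hi2 s hs), integral_integral_swap hsqst,
      intervalIntegral.integral_add intervalIntegrable_const (hqI s t hs0 hst),
      intervalIntegral.integral_of_le (f := q) hst, intervalIntegral.integral_const]
    simp only [smul_eq_mul, mul_one]
    have h5 := hE2 t (hs.trans hst)
    have h6 := hE2 s hs
    change _ + ∫ τ in Ioc s t, q τ ≤ _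
    nlinarith [mul_le_mul_of_nonneg_left (add_le_add h5 h6) hts, mul_nonneg hM0 hq0]
  refine AbsolutelyContinuousOnInterval.of_dist_le (C := m / β * (4 * M + 1)) hψ ?_
  have hmain' : ∀ s ∈ Icc t₁ T, ∀ t ∈ Icc t₁ T, s ≤ t → dist (energy Ω m u t) (energy Ω m u s) ≤
      m / β * (4 * M + 1) * dist (∫ σ in t₁..t, (1 + q σ)) (∫ σ in t₁..s, (1 + q σ)) := by
    intro s hs t ht hst
    rw [Real.dist_eq, Real.dist_eq, intervalIntegral.integral_interval_sub_left
      (intervalIntegrable_const.add (hqI _ _ ht₁0.le ht.1))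
      (intervalIntegrable_const.add (hqI _ _ ht₁0.le hs.1))]
    refine (hmain s t hs.1 hst).trans ?_
    exact mul_le_mul_of_nonneg_left (le_abs_self _) (by positivity)
  intro s hs t ht
  rw [uIcc_of_le hT] at hs ht
  rcases le_total s t with hst | hst
  · rw [dist_comm, dist_comm (∫ σ in t₁..s, _)]
    exact hmain' s hs t ht hst
  · exact hmain' t ht s hs hst

end IsRepresentative

end DegenerateEinstein

/-! ### Conclusion. -/

theorem mainTheorem1 {N : ℕ} (hN : 1 ≤ N) (Ω : Set (DegenerateEinstein.Space N))
    (hΩo : IsOpen Ω) (hΩb : Bornology.IsBounded Ω)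
    (K γ m : ℝ) (hK : 0 < K) (hγ0 : 0 < γ) (hγ1 : γ < 1) (hm : 2 - γ ≤ m) :
    ∃ k₁ : ℝ, 0 < k₁ ∧
      ∀ (u₀ : DegenerateEinstein.Space N → ℝ) (u : DegenerateEinstein.Space N → ℝ → ℝ),
        DegenerateEinstein.IsSolution Ω K γ u₀ u →
        ∀ t₀ : ℝ, 0 ≤ t₀ → IntegrableOn (fun x => (u x t₀) ^ m) Ω →
          ∀ Y : ℝ → ℝ, Y = DegenerateEinstein.energy Ω m u →
            (∀ t : ℝ, t₀ ≤ t → IntegrableOn (fun x => (u x t) ^ m) Ω) ∧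
            (∀ T : ℝ, t₀ ≤ T → AbsolutelyContinuousOnInterval Y t₀ T) ∧
            (∀ᵐ t ∂(volume.restrict (Ioi t₀)), DifferentiableAt ℝ Y t) ∧
            (∀ t : ℝ, t₀ < t → DifferentiableAt ℝ Y t →
              deriv Y t + k₁ * (Y t) ^ ((m + γ) / m) ≤ 0) ∧
            (Y t₀ = 0 → ∀ t : ℝ, t₀ ≤ t → Y t = 0) ∧
            (0 < Y t₀ → ∀ t : ℝ, t₀ ≤ t →
              Y t ≤ (k₁ * (γ / m) * (t - t₀) + (Y t₀) ^ (-(γ / m))) ^ (-(m / γ))) ∧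
            Tendsto Y atTop (𝓝 0) := by
  obtain ⟨c, hc0, hc⟩ := DegenerateEinstein.exists_dissipation hN hΩb
  have : IsFiniteMeasure (volume.restrict Ω) :=
    ⟨by rw [Measure.restrict_apply_univ]; exact hΩb.measure_lt_top⟩
  have hm0 : 0 < m := by linarith
  have hβ : 0 < 1 - γ := by linarith
  have hβ1 : 1 - γ < 1 := by linarith
  have hmβ : 1 + (1 - γ) ≤ m := by linarith
  have hθ : 0 < γ / m := by positivity
  -- The constant of `energy_add_le` for `β = 1 - γ`; `c` comes from Poincaré's inequality and
  -- depends on `Ω` only.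
  set k₁ := 4 * K * c * m * (m - (1 - γ)) / ((1 - γ) * (m + 1 - (1 - γ)) ^ 2) /
      ((volume Ω).toReal + 1) ^ ((1 - (1 - γ)) / m) with hk₁
  have hk0 : 0 < k₁ := by
    have h1 : 0 < m - (1 - γ) := by linarith
    have h3 : 0 < m + 1 - (1 - γ) := by linarith
    positivity
  refine ⟨k₁, hk0, fun u₀ u hu t₀ ht₀ hint Y hY => ?_⟩
  obtain ⟨w, g, h⟩ := hu.exists_isRepresentative hγ1
  have hfin₀ := (h.integrable_rpow_iff hβ ht₀).1 hint
  have hfin : ∀ t, t₀ ≤ t → DegenerateEinstein.lenergy Ω m u t ≠ ⊤ := fun t ht =>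
    ne_top_of_le_ne_top hfin₀ (h.lenergy_anti hβ hK hc0 hc hmβ ht₀ ht)
  have hY0 : ∀ t, t₀ ≤ t → 0 ≤ Y t := fun t ht => by
    rw [hY, h.energy_eq hβ (ht₀.trans ht)]; exact ENNReal.toReal_nonneg
  have hdec : ∀ s t, t₀ ≤ s → s ≤ t → Y t + k₁ * (t - s) * Y t ^ (1 + γ / m) ≤ Y s := by
    intro s t hs hst
    have := h.energy_add_le hβ hβ1 hK hc0 hc hmβ (ht₀.trans hs) hst (hfin s hs)
    rw [← hk₁, sub_sub_cancel, ← hY] at this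
    exact this
  have hanti : ∀ s t, t₀ ≤ s → s ≤ t → Y t ≤ Y s := by
    intro s t hs hst
    have h1 : 0 ≤ k₁ * (t - s) * Y t ^ (1 + γ / m) :=
      mul_nonneg (mul_nonneg hk0.le (sub_nonneg.2 hst)) (Real.rpow_nonneg (hY0 t (hs.trans hst)) _)
    linarith [hdec s t hs hst]
  have hAC : ∀ T, t₀ ≤ T → AbsolutelyContinuousOnInterval Y t₀ T := by
    intro T hT
    refine DegenerateEinstein.AntitoneOn.absolutelyContinuousOnInterval hT
      (fun s hs t _ hst => hanti s t hs.1 hst) ?_ fun t₁ ht₁ hT₁ => ?_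
    · rw [hY]; exact h.tendsto_energy_nhdsGT hβ hK hc0 hc hmβ ht₀ hfin₀
    · rw [hY]
      exact h.absolutelyContinuousOnInterval_energy_of_lt hβ hβ1 hK hc0 hc hmβ ht₀ hfin₀ ht₁ hT₁
  have hcont : ∀ T, ContinuousOn Y (Icc t₀ T) := by
    intro T
    rcases le_total t₀ T with hT | hT
    · rw [← uIcc_of_le hT]; exact (hAC T hT).continuousOn
    · exact (subsingleton_Icc_of_ge hT).continuousOn Y
  have hzero : Y t₀ = 0 → ∀ t, t₀ ≤ t → Y t = 0 := fun h0 t ht =>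
    le_antisymm (h0 ▸ hanti t₀ t le_rfl ht) (hY0 t ht)
  have hbound : 0 < Y t₀ → ∀ t : ℝ, t₀ ≤ t →
      Y t ≤ (k₁ * (γ / m) * (t - t₀) + (Y t₀) ^ (-(γ / m))) ^ (-(m / γ)) := by
    intro hpos t ht
    have := DegenerateEinstein.le_rpow_of_forall_add_le hk0 hθ hcont hdec hpos ht
    rwa [one_div_div] at this
  refine ⟨fun t ht => (h.integrable_rpow_iff hβ (ht₀.trans ht)).2 (hfin t ht), hAC, ?_, ?_, hzero,
    hbound, ?_⟩
  · rw [ae_restrict_iff' measurableSet_Ioi]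
    have : ∀ n : ℕ, ∀ᵐ t, t ∈ uIcc t₀ (t₀ + n) → DifferentiableAt ℝ Y t := fun n =>
      (hAC (t₀ + n) (by simp)).ae_differentiableAt
    filter_upwards [ae_all_iff.2 this] with t ht htt
    obtain ⟨n, hn⟩ := exists_nat_ge (t - t₀)
    refine ht n ?_
    rw [uIcc_of_le (by simp)]
    exact ⟨le_of_lt htt, by linarith⟩
  · intro t ht hd
    rw [show (m + γ) / m = 1 + γ / m by field_simp]
    exact DegenerateEinstein.deriv_add_mul_rpow_le_of_forall_add_le (by positivity) hdec ht.le hd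
  · rcases (hY0 t₀ le_rfl).eq_or_lt with h0 | h0
    · refine tendsto_const_nhds.congr' ?_
      filter_upwards [eventually_ge_atTop t₀] with t ht
      exact (hzero h0.symm t ht).symm
    -- The explicit bound is a negative power of a function that is affine and increasing in `t`.
    · refine squeeze_zero' ?_ ?_ ((tendsto_rpow_neg_atTop (show 0 < m / γ by positivity)).comp
        (tendsto_atTop_add_const_right _ ((Y t₀) ^ (-(γ / m)))
          ((tendsto_atTop_add_const_right _ (-t₀) tendsto_id).const_mul_atTop
            (show 0 < k₁ * (γ / m) by positivity))))
      · filter_upwards [eventually_ge_atTop t₀] with t ht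
        exact hY0 t ht
      · filter_upwards [eventually_ge_atTop t₀] with t ht
        exact hbound h0 t ht
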